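/- Let $F$ be a finite field of characteristic $p$ and let $K$ be a field whose characteristic is different from $p$ (characteristic $0$ is allowed). Let $\mathrm{Rep}(F;K)$ be the abelian category whose objects are the functors from finite-dimensional $F$-vector spaces to $K$-modules and whose morphisms are the natural transformations. Then every projective object of $\mathrm{Rep}(F;K)$ is also injective. Moreover, every indecomposable projective object $P$ of $\mathrm{Rep}(F;K)$ has only finitely many composition factors, that is, there is a finite chain of subobjects $0=P_0\subseteq P_1\subseteq\dots\subseteq P_n=P$ all of whose quotients $P_{i+1}/P_i$ are simple. -/

import Mathlib

open CategoryTheory CategoryTheory.Limits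

universe u v

/-- The category `Rep(F; K)` of generic representations: functors from finite dimensional
`F`-vector spaces to `K`-modules, with natural transformations as morphisms.  The modules live in
a universe that contains both `F` and `K`. -/
abbrev GenericRep (F : Type u) [Field F] (K : Type v) [CommRing K] :=
  FGModuleCat.{u} F ⥤ ModuleCat.{max u v} K

/-- An object `X` of an abelian category has only finitely many composition factors (it has finite
length) if there is a finite chain of subobjects `0 = s 0 ≤ s 1 ≤ ⋯ ≤ s n = X` in which every
quotient `s (i + 1) / s i` is simple. -/
def HasFinitelyManyCompositionFactors {C : Type u} [Category.{v} C] [Abelian C] (X : C) : Prop :=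
  ∃ (n : ℕ) (s : Fin (n + 1) →o Subobject X),
    s 0 = ⊥ ∧ s (Fin.last n) = ⊤ ∧
      ∀ i : Fin n, Simple (cokernel (Subobject.ofLE (s i.castSucc) (s i.succ)
        (s.monotone i.castSucc_le_succ)))

universe w t

/-! Linearize the category of finite-dimensional `F`-spaces over `K`. The central fact
(`exists_isRankIdentity`) is that the ideal spanned by the maps of rank `< n` has a two-sided
identity at every object. Such identities commute with all morphisms, so their successive
differences are orthogonal central idempotents (`layer`), and every functor splits into parts of
pure rank. The rank `n` part is determined by its value at `F^n`, where non-invertible endomorphisms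
act by zero: it amounts to a `K[GL_n(F)]`-module.

For group algebras of finite groups both claims are classical, even when the characteristic of `K`
divides the order of the group. Projectivity makes the identity an average of a linear map
(`exists_average_eq`, Higman's criterion), and averaging against a linear retraction gives
injectivity. The same average, cut down to finite rank, yields an idempotent that forces an
indecomposable projective to be finite-dimensional at `F^n`; its subobjects embed into the subspaces
of that value.

The identities are built by induction on `n` from a nondegenerate pairing between maps out of `F^n`
and maps into it. Nondegeneracy says that a linear combination of maps killed by all composites is
zero (`separatesHoms`). This is Radon inversion for the trace pairing on Hom spaces, and it is the
only place where `p` must be invertible in `K`. -/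

namespace GenericRep

/-! ### Linearized Hom spaces and their action on functors. -/

section LinearHoms

variable (K : Type v) [Field K] {C : Type w} [Category.{u} C]

/-- Formal `K`-linear combinations of morphisms `X ⟶ Y`. -/
abbrev LHom (X Y : C) := Free.of K X ⟶ Free.of K Y

/-- A morphism, as a formal linear combination. -/
noncomputable def sg {X Y : C} (f : X ⟶ Y) : LHom K X Y := (Free.embedding K C).map f

/-- The coefficient of a morphism in a formal linear combination. -/
noncomputable def coef {X Y : C} (f : X ⟶ Y) : LHom K X Y →ₗ[K] K := Finsupp.lapply f

@[simp] lemma sg_id (X : C) : sg K (𝟙 X) = 𝟙 (Free.of K X) := rfl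

lemma sg_comp {X Y Z : C} (f : X ⟶ Y) (g : Y ⟶ Z) : sg K (f ≫ g) = sg K f ≫ sg K g :=
  (Free.embedding K C).map_comp f g

variable {K}

open Classical in
lemma coef_sg {X Y : C} (f g : X ⟶ Y) : coef K f (sg K g) = if g = f then 1 else 0 :=
  Finsupp.single_apply

lemma coef_sg_self {X Y : C} (f : X ⟶ Y) : coef K f (sg K f) = 1 := by simp [coef_sg]

lemma coef_sg_of_ne {X Y : C} {f g : X ⟶ Y} (h : g ≠ f) : coef K f (sg K g) = 0 := by
  simp [coef_sg, h]

lemma coef_sg_congr {X Y X' Y' : C} {f g : X ⟶ Y} {f' g' : X' ⟶ Y'} (h : g = f ↔ g' = f') :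
    coef K f (sg K g) = coef K f' (sg K g') := by
  by_cases hg : g = f
  · rw [hg, h.1 hg, coef_sg_self, coef_sg_self]
  · rw [coef_sg_of_ne hg, coef_sg_of_ne (mt h.2 hg)]

lemma lhom_ext_coef {X Y : C} {x y : LHom K X Y} (h : ∀ f, coef K f x = coef K f y) : x = y :=
  Finsupp.ext h

lemma lhom_induction {X Y : C} {p : LHom K X Y → Prop} (x : LHom K X Y)
    (zero : p 0) (add : ∀ x y, p x → p y → p (x + y))
    (smul_sg : ∀ (c : K) f, p (c • sg K f)) : p x := by
  refine Finsupp.induction_linear (motive := p) x zero add fun f c => ?_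
  have h : c • sg K f = (Finsupp.single f c : (X ⟶ Y) →₀ K) := Finsupp.smul_single_one f c
  exact Eq.subst (motive := p) h (smul_sg c f)

lemma linearMap_ext_sg {X Y : C} {M : Type*} [AddCommGroup M] [Module K M]
    {a b : LHom K X Y →ₗ[K] M} (h : ∀ f, a (sg K f) = b (sg K f)) : a = b :=
  Finsupp.lhom_ext' fun f => LinearMap.ext_ring (h f)

instance [∀ X Y : C, Finite (X ⟶ Y)] (X Y : C) : Module.Finite K (LHom K X Y) :=
  inferInstanceAs (Module.Finite K ((X ⟶ Y) →₀ K))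

lemma sum_coef_smul_sg {X Y : C} [Fintype (X ⟶ Y)] (x : LHom K X Y) :
    ∑ f, coef K f x • sg K f = x := by
  have h : ∑ f : X ⟶ Y, Finsupp.single f (coef K f x) = x :=
    Finsupp.univ_sum_single (α := X ⟶ Y) (M := K) x
  exact (Finset.sum_congr rfl fun f _ => Finsupp.smul_single_one f (coef K f x)).trans h

/-- The coefficient of the identity is a trace. -/
lemma coef_id_comp_comm {X Y : C} (hX : ∀ (f : X ⟶ Y) (g : Y ⟶ X), f ≫ g = 𝟙 X ↔ g ≫ f = 𝟙 Y)
    (x : LHom K X Y) (y : LHom K Y X) : coef K (𝟙 X) (x ≫ y) = coef K (𝟙 Y) (y ≫ x) := by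
  induction x using lhom_induction with
  | zero => simp
  | add x x' h h' => simp [Preadditive.add_comp, Preadditive.comp_add, h, h']
  | smul_sg c f =>
    induction y using lhom_induction with
    | zero => simp
    | add x x' h h' =>
      simp only [Preadditive.comp_add, Preadditive.add_comp, h, h', map_add]
    | smul_sg d g =>
      simp only [Linear.smul_comp, Linear.comp_smul, map_smul, ← sg_comp,
        coef_sg_congr (K := K) (hX f g)]
      exact smul_comm _ _ _

lemma coef_comp_sg_of_iso {X Y Z : C} (g : Y ≅ Z) (f : X ⟶ Z) (x : LHom K X Y) :
    coef K f (x ≫ sg K g.hom) = coef K (f ≫ g.inv) x := by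
  induction x using lhom_induction with
  | zero => simp
  | add x x' h h' => simp [Preadditive.add_comp, h, h']
  | smul_sg c h =>
    simp only [Linear.smul_comp, map_smul, ← sg_comp,
      coef_sg_congr (K := K) (g.eq_comp_inv (f := f) (g := h)).symm]

lemma coef_sg_comp_of_iso {X Y Z : C} (g : X ≅ Y) (f : X ⟶ Z) (x : LHom K Y Z) :
    coef K f (sg K g.hom ≫ x) = coef K (g.inv ≫ f) x := by
  induction x using lhom_induction with
  | zero => simp
  | add x x' h h' => simp [Preadditive.comp_add, h, h']
  | smul_sg c h =>
    simp only [Linear.comp_smul, map_smul, ← sg_comp,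
      coef_sg_congr (K := K) (g.eq_inv_comp (f := f) (g := h)).symm]

open Classical in
/-- A weight on the morphisms out of `X` which has total weight one on the orbit of each
monomorphism under automorphisms of `X`. -/
lemma exists_orbit_weight (K : Type v) [Field K] (X Y : C) [Fintype (X ≅ X)] :
    ∃ wt : (X ⟶ Y) → K, ∀ f : X ⟶ Y, Mono f → ∑ g : X ≅ X, wt (g.hom ≫ f) = 1 := by
  let s : Setoid (X ⟶ Y) :=
    { r := fun f f' => ∃ g : X ≅ X, g.hom ≫ f = f'
      iseqv :=
        { refl := fun f => ⟨Iso.refl X, by simp⟩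
          symm := by
            rintro f _ ⟨g, rfl⟩
            exact ⟨g.symm, by simp⟩
          trans := by
            rintro f _ _ ⟨g, rfl⟩ ⟨h, rfl⟩
            exact ⟨h ≪≫ g, by simp⟩ } }
  -- The weight is the indicator of a chosen orbit representative. Automorphisms act freely on a
  -- monomorphism, so exactly one `g` reaches it. Dividing by the number of automorphisms is not
  -- possible, as it may vanish in `K`.
  refine ⟨fun f => if (Quotient.mk s f).out = f then 1 else 0, fun f hf => ?_⟩
  obtain ⟨g, hg⟩ : s.r f (Quotient.mk s f).out := Setoid.symm (Quotient.mk_out (s := s) f)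
  have hq : ∀ h : X ≅ X, Quotient.mk s (h.hom ≫ f) = Quotient.mk s f := fun h =>
    Quotient.sound (s := s) (Setoid.symm ⟨h, rfl⟩)
  rw [Finset.sum_eq_single g]
  · simp [hq, ← hg]
  · intro h _ hne
    refine if_neg fun heq => hne ?_
    rw [hq, ← hg, cancel_mono] at heq
    exact Iso.ext heq.symm
  · simp

/-- The linear extension of the action of a functor on morphisms. -/
noncomputable def act (G : C ⥤ ModuleCat.{t} K) (X Y : C) :
    LHom K X Y →ₗ[K] (G.obj X ⟶ G.obj Y) :=
  Finsupp.linearCombination K (fun f : X ⟶ Y => G.map f)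

@[simp] lemma act_sg (G : C ⥤ ModuleCat.{t} K) {X Y : C} (f : X ⟶ Y) :
    act G X Y (sg K f) = G.map f := by
  refine (Finsupp.linearCombination_single K (1 : K) f).trans (one_smul _ _)

@[simp] lemma act_id (G : C ⥤ ModuleCat.{t} K) (X : C) :
    act G X X (𝟙 (Free.of K X)) = 𝟙 _ := by
  rw [← sg_id, act_sg, G.map_id]

lemma act_comp (G : C ⥤ ModuleCat.{t} K) {X Y Z : C} (x : LHom K X Y) (y : LHom K Y Z) :
    act G X Z (x ≫ y) = act G X Y x ≫ act G Y Z y := by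
  induction x using lhom_induction with
  | zero => simp
  | add x x' h h' => simp [Preadditive.add_comp, h, h']
  | smul_sg c f =>
    induction y using lhom_induction with
    | zero => simp
    | add x x' h h' => simp only [Preadditive.comp_add, h, h', map_add]
    | smul_sg d g =>
      simp only [Linear.smul_comp, Linear.comp_smul, map_smul, act_sg, ← sg_comp, G.map_comp]

lemma act_naturality {G H : C ⥤ ModuleCat.{t} K} (φ : G ⟶ H) {X Y : C} (x : LHom K X Y) :
    act G X Y x ≫ φ.app Y = φ.app X ≫ act H X Y x := by
  induction x using lhom_induction with
  | zero => simp
  | add x x' h h' => simp [Preadditive.add_comp, Preadditive.comp_add, h, h']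
  | smul_sg c f => simp

end LinearHoms

/-! ### Axioms on rank and separation of morphisms. -/

/-- A category with a notion of rank of morphisms, in which a morphism of rank `n` factors through
a standard object `std n`. -/
class RankedCategory (C : Type w) [Category.{u} C] where
  /-- The rank of a morphism. -/
  rank {X Y : C} (f : X ⟶ Y) : ℕ
  /-- The standard object of each dimension. -/
  std : ℕ → C
  rank_comp_le_left {X Y Z : C} (f : X ⟶ Y) (g : Y ⟶ Z) : rank (f ≫ g) ≤ rank f
  rank_comp_le_right {X Y Z : C} (f : X ⟶ Y) (g : Y ⟶ Z) : rank (f ≫ g) ≤ rank g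
  exists_factorization {X Y : C} (f : X ⟶ Y) :
    ∃ (b : X ⟶ std (rank f)) (a : std (rank f) ⟶ Y), b ≫ a = f
  rank_id_std (n : ℕ) : rank (𝟙 (std n)) = n
  isIso_of_rank_eq {n : ℕ} (f : std n ⟶ std n) : rank f = n → IsIso f
  mono_of_rank_eq {n : ℕ} {Y : C} (f : std n ⟶ Y) : rank f = n → Mono f

/-- Linear combinations of morphisms are detected by composing with morphisms in the other
direction. -/
class SeparatesHoms (K : Type v) [Field K] (C : Type w) [Category.{u} C] : Prop where
  eq_zero_of_comp {X Y : C} (x : LHom K X Y) : (∀ b : Y ⟶ X, x ≫ sg K b = 0) → x = 0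
  eq_zero_of_comp' {X Y : C} (x : LHom K X Y) : (∀ a : Y ⟶ X, sg K a ≫ x = 0) → x = 0

open RankedCategory

/-! ### The ideals of low rank and their identities. -/

section LowRank

variable (K : Type v) [Field K] {C : Type w} [Category.{u} C] [RankedCategory C]

/-- The linear combinations of morphisms of rank `< n`. -/
noncomputable def lowRank (n : ℕ) (X Y : C) : Submodule K (LHom K X Y) :=
  Submodule.span K (sg K '' {f | rank f < n})

variable {K} {n : ℕ} {X Y Z : C}

lemma sg_mem_lowRank {f : X ⟶ Y} (h : rank f < n) : sg K f ∈ lowRank K n X Y :=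
  Submodule.subset_span ⟨f, h, rfl⟩

lemma coef_eq_zero_of_mem_lowRank {x : LHom K X Y} (hx : x ∈ lowRank K n X Y) {f : X ⟶ Y}
    (hf : n ≤ rank f) : coef K f x = 0 := by
  induction hx using Submodule.span_induction with
  | mem x h =>
    obtain ⟨g, hg, rfl⟩ := h
    refine coef_sg_of_ne ?_
    rintro rfl
    exact absurd hg (not_lt.2 hf)
  | zero => simp
  | add x y _ _ hx hy => simp [hx, hy]
  | smul c x _ hx => simp [hx]

lemma mem_lowRank_of_coef [Finite (X ⟶ Y)] {x : LHom K X Y}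
    (hx : ∀ f : X ⟶ Y, n ≤ rank f → coef K f x = 0) : x ∈ lowRank K n X Y := by
  have := Fintype.ofFinite (X ⟶ Y)
  rw [← sum_coef_smul_sg x]
  refine Submodule.sum_mem _ fun f _ => ?_
  by_cases hf : n ≤ rank f
  · simp [hx f hf]
  · exact Submodule.smul_mem _ _ (sg_mem_lowRank (not_le.1 hf))

lemma comp_mem_lowRank_left {x : LHom K X Y} (hx : x ∈ lowRank K n X Y) (y : LHom K Y Z) :
    x ≫ y ∈ lowRank K n X Z := by
  induction hx using Submodule.span_induction with
  | mem x h =>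
    obtain ⟨f, hf, rfl⟩ := h
    induction y using lhom_induction with
    | zero => simp
    | add x y hx hy => simpa only [Preadditive.comp_add] using add_mem hx hy
    | smul_sg c g =>
      rw [Linear.comp_smul, ← sg_comp]
      exact Submodule.smul_mem _ _ (sg_mem_lowRank ((rank_comp_le_left f g).trans_lt hf))
  | zero => simp
  | add x y _ _ hx hy => simpa only [Preadditive.add_comp] using add_mem hx hy
  | smul c x _ hx => simpa only [Linear.smul_comp] using Submodule.smul_mem _ _ hx

lemma comp_mem_lowRank_right (x : LHom K X Y) {y : LHom K Y Z} (hy : y ∈ lowRank K n Y Z) :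
    x ≫ y ∈ lowRank K n X Z := by
  induction hy using Submodule.span_induction with
  | mem y h =>
    obtain ⟨f, hf, rfl⟩ := h
    induction x using lhom_induction with
    | zero => simp
    | add x y hx hy => simpa only [Preadditive.add_comp] using add_mem hx hy
    | smul_sg c g =>
      rw [Linear.smul_comp, ← sg_comp]
      exact Submodule.smul_mem _ _ (sg_mem_lowRank ((rank_comp_le_right g f).trans_lt hf))
  | zero => simp
  | add x y _ _ hx hy => simpa only [Preadditive.comp_add] using add_mem hx hy
  | smul c x _ hx => simpa only [Linear.comp_smul] using Submodule.smul_mem _ _ hx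

lemma lowRank_mono {m n : ℕ} (h : m ≤ n) (X Y : C) : lowRank K m X Y ≤ lowRank K n X Y :=
  Submodule.span_mono (Set.image_mono fun _ hf => lt_of_lt_of_le hf h)

lemma mem_lowRank_of_rank_id_left (h : rank (𝟙 X) < n) (x : LHom K X Y) :
    x ∈ lowRank K n X Y := by
  simpa using comp_mem_lowRank_left (sg_mem_lowRank (K := K) h) x

lemma lowRank_zero_eq_bot (X Y : C) : lowRank K 0 X Y = ⊥ := by
  simp [lowRank]

lemma rank_le_of_from_std (f : std (C := C) n ⟶ Y) : rank f ≤ n := by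
  simpa [rank_id_std] using rank_comp_le_left (𝟙 (std n)) f

lemma rank_le_of_to_std (f : X ⟶ std (C := C) n) : rank f ≤ n := by
  simpa [rank_id_std] using rank_comp_le_right f (𝟙 (std n))

/-- A one-sided inverse on `std n` has full rank, hence is invertible. Through `coef_id_comp_comm`
this makes the coefficient of the identity a trace form on linear combinations of endomorphisms of
`std n`. -/
lemma comp_eq_id_comm (f g : std (C := C) n ⟶ std n) : f ≫ g = 𝟙 _ ↔ g ≫ f = 𝟙 _ := by
  have key : ∀ f g : std (C := C) n ⟶ std n, f ≫ g = 𝟙 _ → g ≫ f = 𝟙 _ := by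
    intro f g h
    have hf : IsIso f := by
      refine isIso_of_rank_eq f (le_antisymm (rank_le_of_to_std f) ?_)
      exact ((rank_id_std (C := C) n).symm.trans_le (by rw [← h])).trans (rank_comp_le_left f g)
    rw [← IsIso.eq_inv_comp] at h
    rw [h]
    simp
  exact ⟨key f g, key g f⟩

variable (K) in
/-- An endomorphism which is a two-sided identity for the ideal of linear combinations of
morphisms of rank `< n`. -/
structure IsRankIdentity (n : ℕ) (X : C) (ε : LHom K X X) : Prop where
  mem : ε ∈ lowRank K n X X
  comp_eq {Y : C} (x : LHom K Y X) : x ∈ lowRank K n Y X → x ≫ ε = x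
  eq_comp {Y : C} (x : LHom K X Y) : x ∈ lowRank K n X Y → ε ≫ x = x

/-- Both sides equal `ε ≫ x ≫ ε'`, because the low-rank combinations form a two-sided ideal. This
gives centrality. -/
lemma IsRankIdentity.natural {ε : LHom K X X} {ε' : LHom K Y Y} (h : IsRankIdentity K n X ε)
    (h' : IsRankIdentity K n Y ε') (x : LHom K X Y) : ε ≫ x = x ≫ ε' := by
  rw [← h'.comp_eq _ (comp_mem_lowRank_left h.mem x), Category.assoc,
    h.eq_comp _ (comp_mem_lowRank_right x h'.mem)]

end LowRank


/-! ### Inductive construction of the rank identities. -/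

section RankIdentities

variable {K : Type v} [Field K] {C : Type w} [Category.{u} C] [RankedCategory C]
  {n : ℕ}

lemma exists_factorization_of_rank_eq {X Y : C} (f : X ⟶ Y) (h : rank f = n) :
    ∃ (b : X ⟶ std n) (a : std n ⟶ Y), b ≫ a = f := by
  subst h
  exact exists_factorization f

lemma comp_eq_zero_of_mem_lowRank {X Y Z : C} {ε : LHom K Y Y} (h : IsRankIdentity K n Y ε)
    {x : LHom K X Y} (hx : x ∈ lowRank K n X Y) {y : LHom K Y Z} (hy : ε ≫ y = 0) :
    x ≫ y = 0 := by
  rw [← h.comp_eq x hx, Category.assoc, hy, comp_zero]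

lemma comp_eq_zero_of_mem_lowRank' {X Y Z : C} {ε : LHom K Y Y} (h : IsRankIdentity K n Y ε)
    {x : LHom K X Y} (hx : x ≫ ε = 0) {y : LHom K Y Z} (hy : y ∈ lowRank K n Y Z) :
    x ≫ y = 0 := by
  rw [← h.eq_comp y hy, ← Category.assoc, hx, zero_comp]

variable [∀ X Y : C, Finite (X ⟶ Y)]

lemma mem_lowRank_of_coef_iso {x : LHom K (std (C := C) n) (std n)}
    (h : ∀ g : std (C := C) n ≅ std n, coef K g.hom x = 0) : x ∈ lowRank K n (std n) (std n) := by
  refine mem_lowRank_of_coef fun f hf => ?_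
  have := isIso_of_rank_eq f (le_antisymm (rank_le_of_to_std f) hf)
  exact h (asIso f)

instance (X Y : C) : Finite (X ≅ Y) :=
  Finite.of_injective (fun g : X ≅ Y => g.hom) fun _ _ h => Iso.ext h

/-- A linear combination of endomorphisms of `std n` agrees with its invertible part up to
morphisms of smaller rank. -/
lemma sub_sum_iso_mem_lowRank [Fintype (std (C := C) n ≅ std n)]
    (x : LHom K (std (C := C) n) (std n)) :
    x - ∑ g : std (C := C) n ≅ std n, coef K g.hom x • sg K g.hom ∈
      lowRank K n (std n) (std n) := by
  refine mem_lowRank_of_coef_iso fun g => ?_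
  rw [map_sub, map_sum, Finset.sum_eq_single g, map_smul, coef_sg_self, smul_eq_mul, mul_one,
    sub_self]
  · intro h _ hne
    rw [map_smul, coef_sg_of_ne fun heq => hne (Iso.ext heq), smul_zero]
  · simp

variable {ε : LHom K (std (C := C) n) (std n)} {W : C}

variable [SeparatesHoms K C]

/-- Left nondegeneracy of the pairing `(x, y) ↦ coef K (𝟙 _) (x ≫ y)`. If `x` pairs to zero with
everything, then each `x ≫ sg K b` has no invertible part, so `ε` fixes it; but `ε` kills `x`. -/
lemma eq_zero_of_coef_id_comp (hε : IsRankIdentity K n (std n) ε) {x : LHom K (std n) W}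
    (hx : ε ≫ x = 0) (h : ∀ y : LHom K W (std n), y ≫ ε = 0 → coef K (𝟙 (std n)) (x ≫ y) = 0) :
    x = 0 := by
  refine SeparatesHoms.eq_zero_of_comp x fun b => ?_
  have hmem : x ≫ sg K b ∈ lowRank K n (std n) (std n) := by
    refine mem_lowRank_of_coef_iso fun g => ?_
    -- The test element is `b ≫ g⁻¹` corrected by `𝟙 - ε` so that `ε` kills it. The correction has
    -- low rank and does not change the coefficient of the identity.
    have hlow : (x ≫ sg K b ≫ sg K g.inv) ≫ ε ∈ lowRank K n (std n) (std n) :=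
      comp_mem_lowRank_right _ hε.mem
    have h1 := h (sg K b ≫ sg K g.inv ≫ (𝟙 _ - ε)) (by
      simp [Preadditive.comp_sub, Preadditive.sub_comp, hε.comp_eq _ hε.mem])
    have h2 := coef_eq_zero_of_mem_lowRank hlow (f := 𝟙 (std n)) (rank_id_std n).ge
    have h3 := coef_comp_sg_of_iso g.symm (𝟙 _) (x ≫ sg K b)
    simp only [Preadditive.comp_sub, Category.comp_id, map_sub, Category.assoc] at h1 h2 h3
    rw [h2, sub_zero] at h1
    simpa [h1] using h3.symm
  rw [← hε.eq_comp _ hmem, ← Category.assoc, hx, zero_comp]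

lemma exists_coef_id_comp_eq (hε : IsRankIdentity K n (std n) ε) (φ : LHom K (std n) W →ₗ[K] K) :
    ∃ y : LHom K W (std n), y ≫ ε = 0 ∧
      ∀ x : LHom K (std n) W, ε ≫ x = 0 → coef K (𝟙 (std n)) (x ≫ y) = φ x := by
  let L : Submodule K (LHom K (std n) W) := LinearMap.ker (Linear.leftComp K (Free.of K W) ε)
  let R : Submodule K (LHom K W (std n)) := LinearMap.ker (Linear.rightComp K (Free.of K W) ε)
  let B : L →ₗ[K] R →ₗ[K] K := LinearMap.mk₂ K (fun x y => coef K (𝟙 (std n)) (x.1 ≫ y.1))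
    (by intros; simp [Preadditive.add_comp]) (by intros; simp)
    (by intros; simp [Preadditive.comp_add]) (by intros; simp)
  have hB : Function.Injective B := by
    rw [injective_iff_map_eq_zero]
    intro x hx
    refine Subtype.ext (eq_zero_of_coef_id_comp hε x.2 fun y hy => ?_)
    exact LinearMap.congr_fun hx ⟨y, hy⟩
  -- In finite dimension, injectivity of `L → R*` is equivalent to surjectivity of `R → L*`.
  obtain ⟨y, hy⟩ := LinearMap.flip_surjective_iff₁.2 hB (φ ∘ₗ L.subtype)
  exact ⟨y.1, y.2, fun x hx => LinearMap.congr_fun hy ⟨x, hx⟩⟩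

omit [∀ X Y : C, Finite (X ⟶ Y)] in
lemma eq_zero_of_forall_comp_eq_zero (hε : IsRankIdentity K n (std n) ε) {y : LHom K W (std n)}
    (hy : y ≫ ε = 0) (h : ∀ x : LHom K (std n) W, ε ≫ x = 0 → x ≫ y = 0) : y = 0 := by
  refine SeparatesHoms.eq_zero_of_comp' y fun a => ?_
  have h1 : ε ≫ sg K a ≫ y = 0 := by
    rw [← hε.comp_eq (ε ≫ sg K a ≫ y) (comp_mem_lowRank_left hε.mem _)]
    simp [hy]
  have h2 := h ((𝟙 _ - ε) ≫ sg K a) (by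
    rw [← Category.assoc, Preadditive.comp_sub, hε.comp_eq _ hε.mem]
    simp)
  simpa [Preadditive.sub_comp, h1] using h2

/-- The identity for the rank `n` part of the endomorphisms of `W`. -/
lemma exists_identity_of_rank_eq (hε : IsRankIdentity K n (std n) ε) (W : C) :
    ∃ e : LHom K W W, e ∈ lowRank K (n + 1) W W ∧
      (∀ x : LHom K (std n) W, ε ≫ x = 0 → x ≫ e = x) ∧
      (∀ y : LHom K W (std n), y ≫ ε = 0 → e ≫ y = y) ∧
      (∀ (X : C) (x : LHom K X W), x ∈ lowRank K n X W → x ≫ e = 0) ∧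
      (∀ (X : C) (x : LHom K W X), x ∈ lowRank K n W X → e ≫ x = 0) := by
  have := Fintype.ofFinite (std (C := C) n ≅ std n)
  have := Fintype.ofFinite (std n ⟶ W)
  obtain ⟨wt, hwt⟩ := exists_orbit_weight K (std n) W
  choose y hyε hy using fun a : std n ⟶ W => exists_coef_id_comp_eq hε (coef K a)
  have hη : ε ≫ (𝟙 _ - ε) = 0 := by
    rw [Preadditive.comp_sub, hε.comp_eq _ hε.mem]; simp
  have hη' : (𝟙 _ - ε) ≫ ε = 0 := by
    rw [Preadditive.sub_comp, hε.comp_eq _ hε.mem]; simp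
  -- `y a` represents the coefficient at `a`, so expanding `x` through the pairs `(y a, a)` recovers
  -- it, except that each monomorphism occurs once per automorphism of `std n`. The weight `wt`
  -- removes this multiplicity.
  set e : LHom K W W := ∑ a, wt a • (y a ≫ (𝟙 _ - ε) ≫ sg K a) with he
  have hcomm : ∀ g : LHom K (std n) (std n), ε ≫ g = g ≫ ε := fun g => hε.natural hε g
  have hLe : ∀ x : LHom K (std n) W, ε ≫ x = 0 → x ≫ e = x := by
    intro x hx
    have hxy : ∀ a, x ≫ y a ≫ (𝟙 _ - ε) =
        ∑ g : std (C := C) n ≅ std n, coef K (g.hom ≫ a) x • (sg K g.hom ≫ (𝟙 _ - ε)) := by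
      intro a
      have h1 := comp_eq_zero_of_mem_lowRank hε (sub_sum_iso_mem_lowRank (x ≫ y a)) hη
      rw [Preadditive.sub_comp, sub_eq_zero, Category.assoc] at h1
      rw [h1, Preadditive.sum_comp]
      refine Finset.sum_congr rfl fun g _ => ?_
      rw [Linear.smul_comp]
      congr 1
      have h2 : coef K g.hom (x ≫ y a) = coef K (𝟙 (std n)) ((x ≫ y a) ≫ sg K g.inv) := by
        simpa using (coef_comp_sg_of_iso g.symm (𝟙 _) (x ≫ y a)).symm
      -- The trace property moves `g⁻¹` to the front, where it is absorbed into `x`; then `y a`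
      -- reads off a coefficient of `g⁻¹ ≫ x`.
      rw [h2, coef_id_comp_comm comp_eq_id_comm, ← Category.assoc, hy]
      · exact coef_sg_comp_of_iso g.symm a x
      · rw [← Category.assoc, hcomm, Category.assoc, hx, comp_zero]
    have hη1 : ∀ f : std n ⟶ W, ¬ Mono f → (𝟙 _ - ε) ≫ sg K f = 0 := by
      intro f hf
      have : rank f < n := (rank_le_of_from_std f).lt_of_ne fun h => hf (mono_of_rank_eq f h)
      exact comp_eq_zero_of_mem_lowRank' hε hη' (sg_mem_lowRank this)
    calc x ≫ e = ∑ a, wt a • ((x ≫ y a ≫ (𝟙 _ - ε)) ≫ sg K a) := by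
          simp [he, Preadditive.comp_sum]
      _ = ∑ a, ∑ g : std (C := C) n ≅ std n,
            (wt a * coef K (g.hom ≫ a) x) • ((𝟙 _ - ε) ≫ sg K (g.hom ≫ a)) := by
          refine Finset.sum_congr rfl fun a _ => ?_
          rw [hxy, Preadditive.sum_comp, Finset.smul_sum]
          refine Finset.sum_congr rfl fun g _ => ?_
          rw [Linear.smul_comp, smul_smul, sg_comp]
          congr 1
          have : sg K g.hom ≫ (𝟙 _ - ε) = (𝟙 _ - ε) ≫ sg K g.hom := by
            simp [Preadditive.comp_sub, Preadditive.sub_comp, hcomm]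
          rw [this, Category.assoc]
      _ = ∑ g : std (C := C) n ≅ std n, ∑ f : std n ⟶ W,
            (wt (g.inv ≫ f) * coef K f x) • ((𝟙 _ - ε) ≫ sg K f) := by
          rw [Finset.sum_comm]
          refine Finset.sum_congr rfl fun g _ => ?_
          refine Fintype.sum_equiv (Iso.homFromEquiv (Z := W) g.symm) _ _ fun a => ?_
          simp
      _ = ∑ f : std n ⟶ W, coef K f x • ((𝟙 _ - ε) ≫ sg K f) := by
          rw [Finset.sum_comm]
          refine Finset.sum_congr rfl fun f _ => ?_
          by_cases hf : Mono f
          · rw [← Finset.sum_smul, ← Finset.sum_mul]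
            have : ∑ g : std (C := C) n ≅ std n, wt (g.inv ≫ f) = 1 := by
              rw [← hwt f hf]
              exact Fintype.sum_equiv ⟨Iso.symm, Iso.symm, fun _ => rfl, fun _ => rfl⟩ _ _
                fun _ => rfl
            rw [this, one_mul]
          · simp [hη1 f hf]
      _ = (𝟙 _ - ε) ≫ ∑ f : std n ⟶ W, coef K f x • sg K f := by
          simp [Preadditive.comp_sum]
      _ = x := by
          rw [sum_coef_smul_sg, Preadditive.sub_comp, hx]; simp
  have hlow : ∀ (X : C) (x : LHom K X W), x ∈ lowRank K n X W → x ≫ e = 0 := by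
    intro X x hx
    rw [he, Preadditive.comp_sum]
    refine Finset.sum_eq_zero fun a _ => ?_
    rw [Linear.comp_smul, ← Category.assoc, ← hε.comp_eq _ (comp_mem_lowRank_left hx (y a)),
      Category.assoc x, hyε]
    simp
  refine ⟨e, ?_, hLe, fun z hz => ?_, hlow, fun X x hx => ?_⟩
  · refine Submodule.sum_mem _ fun a _ => Submodule.smul_mem _ _ ?_
    refine comp_mem_lowRank_right _ (comp_mem_lowRank_left ?_ _)
    exact mem_lowRank_of_rank_id_left (by simp [rank_id_std]) _
  -- The left identity property comes from the right one: `e ≫ z - z` is killed by `ε` and by every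
  -- `x` with `ε ≫ x = 0`, since `x ≫ e = x`.
  · rw [← sub_eq_zero]
    refine eq_zero_of_forall_comp_eq_zero hε ?_ fun x hx => ?_
    · simp [Preadditive.sub_comp, hz]
    · rw [Preadditive.comp_sub, ← Category.assoc, hLe x hx, sub_self]
  · rw [he, Preadditive.sum_comp]
    refine Finset.sum_eq_zero fun a _ => ?_
    rw [Linear.smul_comp, Category.assoc, Category.assoc,
      comp_eq_zero_of_mem_lowRank' hε hη' (comp_mem_lowRank_right _ hx)]
    simp

/-- The new identity is `εW + e`, with `εW` acting on ranks below `n` and `e` on the complement in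
rank `n`. It suffices to treat maps from and to `std n`, through which every rank `n` map factors;
these split by means of `ε` and `𝟙 - ε`. -/
lemma exists_isRankIdentity_succ (ih : ∀ X : C, ∃ ε, IsRankIdentity K n X ε) (W : C) :
    ∃ ε, IsRankIdentity K (n + 1) W ε := by
  obtain ⟨ε, hε⟩ := ih (std n)
  obtain ⟨εW, hW⟩ := ih W
  obtain ⟨e, hmem, h1, h2, h3, h4⟩ := exists_identity_of_rank_eq hε W
  have hη : ε ≫ (𝟙 _ - ε) = 0 := by
    rw [Preadditive.comp_sub, hε.comp_eq _ hε.mem]; simp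
  have hη' : (𝟙 _ - ε) ≫ ε = 0 := by
    rw [Preadditive.sub_comp, hε.comp_eq _ hε.mem]; simp
  have low : ∀ {X : C} (x : LHom K X W), x ∈ lowRank K n X W → x ≫ (εW + e) = x := by
    intro X x hx
    rw [Preadditive.comp_add, hW.comp_eq x hx, h3 X x hx, add_zero]
  have low' : ∀ {X : C} (x : LHom K W X), x ∈ lowRank K n W X → (εW + e) ≫ x = x := by
    intro X x hx
    rw [Preadditive.add_comp, hW.eq_comp x hx, h4 X x hx, add_zero]
  have main : ∀ a : std n ⟶ W, sg K a ≫ (εW + e) = sg K a := by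
    intro a
    have ha : sg K a = (𝟙 _ - ε) ≫ sg K a + ε ≫ sg K a := by simp [Preadditive.sub_comp]
    have hL : ((𝟙 _ - ε) ≫ sg K a) ≫ (εW + e) = (𝟙 _ - ε) ≫ sg K a := by
      rw [Preadditive.comp_add, h1 _ (by rw [← Category.assoc, hη, zero_comp]), Category.assoc,
        comp_eq_zero_of_mem_lowRank' hε hη' (comp_mem_lowRank_right _ hW.mem), zero_add]
    conv_lhs => rw [ha, Preadditive.add_comp, hL, low _ (comp_mem_lowRank_left hε.mem _)]
    exact ha.symm
  have main' : ∀ b : W ⟶ std n, (εW + e) ≫ sg K b = sg K b := by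
    intro b
    have hb : sg K b = sg K b ≫ (𝟙 _ - ε) + sg K b ≫ ε := by simp [Preadditive.comp_sub]
    have hR : (εW + e) ≫ sg K b ≫ (𝟙 _ - ε) = sg K b ≫ (𝟙 _ - ε) := by
      rw [Preadditive.add_comp, h2 _ (by rw [Category.assoc, hη', comp_zero]), ← Category.assoc,
        comp_eq_zero_of_mem_lowRank hε (comp_mem_lowRank_left hW.mem _) hη, zero_add]
    conv_lhs => rw [hb, Preadditive.comp_add, hR, low' _ (comp_mem_lowRank_right _ hε.mem)]
    exact hb.symm
  refine ⟨εW + e, add_mem (lowRank_mono n.le_succ _ _ hW.mem) hmem, ?_, ?_⟩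
  · intro Y x hx
    induction hx using Submodule.span_induction with
    | mem x h =>
      obtain ⟨f, hf, rfl⟩ := h
      rcases (Nat.lt_succ_iff.1 hf).lt_or_eq with hlt | heq
      · exact low _ (sg_mem_lowRank hlt)
      · obtain ⟨b, a, rfl⟩ := exists_factorization_of_rank_eq f heq
        rw [sg_comp, Category.assoc, main]
    | zero => simp
    | add x y _ _ hx hy => rw [Preadditive.add_comp, hx, hy]
    | smul c x _ hx => rw [Linear.smul_comp, hx]
  · intro Y x hx
    induction hx using Submodule.span_induction with
    | mem x h =>
      obtain ⟨f, hf, rfl⟩ := h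
      rcases (Nat.lt_succ_iff.1 hf).lt_or_eq with hlt | heq
      · exact low' _ (sg_mem_lowRank hlt)
      · obtain ⟨b, a, rfl⟩ := exists_factorization_of_rank_eq f heq
        rw [sg_comp, ← Category.assoc, main']
    | zero => simp
    | add x y _ _ hx hy => rw [Preadditive.comp_add, hx, hy]
    | smul c x _ hx => rw [Linear.comp_smul, hx]

variable (K) in
theorem exists_isRankIdentity (n : ℕ) (X : C) : ∃ ε, IsRankIdentity K n X ε := by
  induction n generalizing X with
  | zero =>
    refine ⟨0, zero_mem _, fun x hx => ?_, fun x hx => ?_⟩ <;>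
    · rw [lowRank_zero_eq_bot] at hx
      rw [(Submodule.mem_bot K).1 hx]
      simp
  | succ n ih => exact exists_isRankIdentity_succ ih X

end RankIdentities

/-! ### Central idempotents of pure rank. -/

section Layers

variable (K : Type v) [Field K] {C : Type w} [Category.{u} C] [RankedCategory C]
  [∀ X Y : C, Finite (X ⟶ Y)] [SeparatesHoms K C]

/-- The identity of the ideal of linear combinations of morphisms of rank `< n`. -/
noncomputable def lowId (n : ℕ) (X : C) : LHom K X X := (exists_isRankIdentity K n X).choose

variable {K} in
lemma lowId_spec (n : ℕ) (X : C) : IsRankIdentity K n X (lowId K n X) :=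
  (exists_isRankIdentity K n X).choose_spec

/-- The central idempotent which projects to the rank `n` part. -/
noncomputable def layer (n : ℕ) (X : C) : LHom K X X := lowId K (n + 1) X - lowId K n X

variable {K} {n : ℕ} {X Y : C}

lemma layer_natural (n : ℕ) (x : LHom K X Y) : layer K n X ≫ x = x ≫ layer K n Y := by
  simp only [layer, Preadditive.sub_comp, Preadditive.comp_sub,
    (lowId_spec _ X).natural (lowId_spec _ Y) x]

lemma layer_mem_lowRank : layer K n X ∈ lowRank K (n + 1) X X :=
  sub_mem (lowId_spec (n + 1) X).mem (lowRank_mono n.le_succ _ _ (lowId_spec n X).mem)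

lemma layer_comp_eq_zero {x : LHom K X Y} (hx : x ∈ lowRank K n X Y) : layer K n X ≫ x = 0 := by
  rw [layer, Preadditive.sub_comp, (lowId_spec n X).eq_comp x hx,
    (lowId_spec (n + 1) X).eq_comp x (lowRank_mono n.le_succ _ _ hx), sub_self]

lemma comp_layer_eq_zero {x : LHom K X Y} (hx : x ∈ lowRank K n X Y) : x ≫ layer K n Y = 0 := by
  rw [← layer_natural, layer_comp_eq_zero hx]

lemma layer_comp_layer_of_lt {m n : ℕ} (h : m < n) : layer K n X ≫ layer K m X = 0 :=
  layer_comp_eq_zero (lowRank_mono h _ _ layer_mem_lowRank)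

lemma layer_comp_layer_of_ne {m n : ℕ} (h : m ≠ n) : layer K m X ≫ layer K n X = 0 := by
  rcases h.lt_or_gt with h | h
  · rw [layer_natural, layer_comp_layer_of_lt h]
  · exact layer_comp_layer_of_lt h

@[simp] lemma layer_comp_layer : layer K n X ≫ layer K n X = layer K n X := by
  have h1 : layer K n X ≫ lowId K (n + 1) X = layer K n X :=
    (lowId_spec _ X).comp_eq _ layer_mem_lowRank
  have h2 : layer K n X ≫ lowId K n X = 0 := layer_comp_eq_zero (lowId_spec n X).mem
  nth_rewrite 2 [layer]
  rw [Preadditive.comp_sub, h1, h2, sub_zero]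

@[simp] lemma layer_comp_layer_assoc (x : LHom K X Y) :
    layer K n X ≫ layer K n X ≫ x = layer K n X ≫ x := by
  rw [← Category.assoc, layer_comp_layer]

/-- The sum telescopes, and once `N` exceeds the rank of `𝟙 X` the ideal contains `𝟙 X`, so its
identity is `𝟙 X`. -/
lemma sum_layer (N : ℕ) (hN : rank (𝟙 X) < N) :
    ∑ i ∈ Finset.range N, layer K i X = 𝟙 (Free.of K X) := by
  have h0 : lowId K 0 X = 0 := by
    have := (lowId_spec (K := K) 0 X).mem
    rwa [lowRank_zero_eq_bot, Submodule.mem_bot] at this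
  have hN' : lowId K N X = 𝟙 _ := by
    have := (lowId_spec (K := K) N X).eq_comp (𝟙 _) (mem_lowRank_of_rank_id_left hN _)
    simpa using this
  simp only [layer]
  rw [Finset.sum_range_sub (fun i => lowId K i X), h0, hN', sub_zero]

lemma layer_eq_zero (h : rank (𝟙 X) < n) : layer K n X = 0 := by
  simpa using layer_comp_eq_zero (mem_lowRank_of_rank_id_left h (𝟙 (Free.of K X)))

-- A layer kills lower ranks, and what remains factors through `std n`. This is what makes the rank
-- `n` part of a functor depend only on its value at `std n`.
open Classical in
lemma exists_layer_comp_eq_sum [Fintype (X ⟶ std (C := C) n)] {z : LHom K X Y}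
    (hz : z ∈ lowRank K (n + 1) X Y) :
    ∃ x : (X ⟶ std (C := C) n) → LHom K (std n) Y, layer K n X ≫ z = ∑ b, sg K b ≫ x b := by
  induction hz using Submodule.span_induction with
  | mem z h =>
    obtain ⟨f, hf, rfl⟩ := h
    rcases (Nat.lt_succ_iff.1 hf).lt_or_eq with hlt | heq
    · exact ⟨0, by simp [layer_comp_eq_zero (sg_mem_lowRank (K := K) hlt)]⟩
    · obtain ⟨b, a, rfl⟩ := exists_factorization_of_rank_eq f heq
      refine ⟨Pi.single b (layer K n _ ≫ sg K a), ?_⟩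
      rw [Finset.sum_eq_single b]
      · rw [Pi.single_eq_same, sg_comp, ← Category.assoc, layer_natural, Category.assoc]
      · intro c _ hc
        rw [Pi.single_eq_of_ne hc, comp_zero]
      · simp
  | zero => exact ⟨0, by simp⟩
  | add z z' _ _ hz hz' =>
    obtain ⟨x, hx⟩ := hz
    obtain ⟨x', hx'⟩ := hz'
    exact ⟨x + x', by simp [Preadditive.comp_add, hx, hx', Finset.sum_add_distrib]⟩
  | smul c z _ hz =>
    obtain ⟨x, hx⟩ := hz
    exact ⟨c • x, by simp [hx, Finset.smul_sum]⟩

variable (K) in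
lemma exists_layer_eq_sum (n : ℕ) (X : C) [Fintype (X ⟶ std (C := C) n)] :
    ∃ x : (X ⟶ std (C := C) n) → LHom K (std n) X, layer K n X = ∑ b, sg K b ≫ x b := by
  obtain ⟨x, hx⟩ := exists_layer_comp_eq_sum (layer_mem_lowRank (K := K) (n := n) (X := X))
  exact ⟨x, by rw [← hx, layer_comp_layer]⟩

end Layers

/-! ### Rank decomposition of functors and averaging. -/

section Functors

variable {K : Type v} [Field K] {C : Type w} [Category.{u} C] [RankedCategory C]
  [∀ X Y : C, Finite (X ⟶ Y)] [SeparatesHoms K C] {n : ℕ} {G H : C ⥤ ModuleCat.{t} K}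

variable (n G) in
/-- The projection of a functor to its rank `n` part. -/
@[simps]
noncomputable def layerMap : G ⟶ G where
  app X := act G X X (layer K n X)
  naturality X Y f := by
    rw [← act_sg, ← act_comp, ← act_comp, layer_natural]

lemma layerMap_idem : layerMap n G ≫ layerMap n G = layerMap n G := by
  ext X : 2
  simp [← act_comp]

lemma layerMap_naturality (φ : G ⟶ H) : layerMap n G ≫ φ = φ ≫ layerMap n H := by
  ext X : 2
  simp [act_naturality]

/-- A natural transformation supported in rank `n` is determined by its value at `std n`. -/
lemma natTrans_ext_of_layerMap {φ ψ : G ⟶ H} (hφ : layerMap n G ≫ φ = φ)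
    (hψ : layerMap n G ≫ ψ = ψ) (h : φ.app (std n) = ψ.app (std n)) : φ = ψ := by
  ext X : 2
  have := Fintype.ofFinite (X ⟶ std (C := C) n)
  obtain ⟨x, hx⟩ := exists_layer_eq_sum K n X
  have key : ∀ θ : G ⟶ H, layerMap n G ≫ θ = θ → θ.app X =
      ∑ b : X ⟶ std (C := C) n, G.map b ≫ θ.app (std n) ≫ act H _ _ (x b) := by
    intro θ hθ
    conv_lhs => rw [← hθ]
    rw [NatTrans.comp_app, layerMap_app, hx, map_sum, Preadditive.sum_comp]
    refine Finset.sum_congr rfl fun b _ => ?_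
    rw [act_comp, act_sg, Category.assoc, act_naturality]
  rw [key φ hφ, key ψ hψ, h]

/-- A map between the values at `std n` which is linear over endomorphisms extends to a natural
transformation. -/
lemma exists_natTrans (φ : G.obj (std n) ⟶ H.obj (std n))
    (hφ : ∀ a, act G _ _ a ≫ φ = φ ≫ act H _ _ a)
    (hφ' : act G _ _ (layer K n (std n)) ≫ φ = φ) :
    ∃ Φ : G ⟶ H, Φ.app (std n) = φ ∧ layerMap n G ≫ Φ = Φ := by
  have := fun X : C => Fintype.ofFinite (X ⟶ std (C := C) n)
  choose x hx using fun X : C => exists_layer_eq_sum K n X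
  have hφ2 : φ ≫ act H _ _ (layer K n (std n)) = φ := by rw [← hφ, hφ']
  -- Since `layer K n X = ∑ b, sg K b ≫ x X b`, naturality forces this formula for any extension
  -- supported in rank `n`.
  let Φ : G ⟶ H :=
    { app := fun X => ∑ b : X ⟶ std (C := C) n, G.map b ≫ φ ≫ act H _ _ (x X b)
      naturality := by
        intro X Y h
        have h1 : ∀ z : LHom K (std n) Y, φ ≫ act H _ _ z =
            ∑ b : Y ⟶ std (C := C) n, act G _ _ (z ≫ sg K b) ≫ φ ≫ act H _ _ (x Y b) := by
          intro z
          conv_lhs => rw [← hφ2]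
          rw [Category.assoc, ← act_comp, layer_natural, hx, Preadditive.comp_sum, map_sum,
            Preadditive.comp_sum]
          refine Finset.sum_congr rfl fun b _ => ?_
          rw [← Category.assoc z, act_comp H, ← Category.assoc φ, ← hφ, Category.assoc]
        symm
        calc (∑ b : X ⟶ std (C := C) n, G.map b ≫ φ ≫ act H _ _ (x X b)) ≫ H.map h
            = ∑ b : X ⟶ std (C := C) n, ∑ c : Y ⟶ std (C := C) n,
                act G _ _ (sg K b ≫ x X b ≫ sg K h ≫ sg K c) ≫ φ ≫ act H _ _ (x Y c) := by
              rw [Preadditive.sum_comp]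
              refine Finset.sum_congr rfl fun b _ => ?_
              rw [Category.assoc, Category.assoc, ← act_sg H, ← act_comp, h1,
                Preadditive.comp_sum]
              refine Finset.sum_congr rfl fun c _ => ?_
              rw [act_comp G (sg K b), act_sg]
              simp only [Category.assoc]
          _ = ∑ c : Y ⟶ std (C := C) n,
                act G _ _ (layer K n X ≫ sg K h ≫ sg K c) ≫ φ ≫ act H _ _ (x Y c) := by
              rw [Finset.sum_comm]
              refine Finset.sum_congr rfl fun c _ => ?_
              rw [hx, Preadditive.sum_comp, map_sum, Preadditive.sum_comp]
              simp only [Category.assoc]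
          _ = G.map h ≫ ∑ c : Y ⟶ std (C := C) n, G.map c ≫ φ ≫ act H _ _ (x Y c) := by
              rw [Preadditive.comp_sum]
              refine Finset.sum_congr rfl fun c _ => ?_
              rw [← sg_comp, layer_natural, act_comp, act_sg, G.map_comp, Category.assoc,
                ← Category.assoc _ φ, hφ', Category.assoc] }
  refine ⟨Φ, ?_, ?_⟩
  · change ∑ b : std (C := C) n ⟶ std n, G.map b ≫ φ ≫ act H _ _ (x (std n) b) = φ
    conv_rhs => rw [← hφ2, hx, map_sum, Preadditive.comp_sum]
    refine Finset.sum_congr rfl fun b _ => ?_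
    rw [act_comp, ← Category.assoc φ, ← hφ (sg K b), act_sg, Category.assoc]
  · ext X : 2
    rw [NatTrans.comp_app, layerMap_app]
    change _ ≫ ∑ b : X ⟶ std (C := C) n, G.map b ≫ φ ≫ act H _ _ (x X b) =
      ∑ b : X ⟶ std (C := C) n, G.map b ≫ φ ≫ act H _ _ (x X b)
    rw [Preadditive.comp_sum]
    refine Finset.sum_congr rfl fun b _ => ?_
    rw [← act_sg, ← Category.assoc, ← act_comp, layer_natural, act_comp, Category.assoc,
      ← Category.assoc _ φ, hφ']

/-- A family of natural transformations supported in each rank has a sum. -/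
lemma exists_natTrans_sum (Φ : ℕ → (G ⟶ H)) (hΦ : ∀ n, layerMap n G ≫ Φ n = Φ n) :
    ∃ Ψ : G ⟶ H, ∀ (X : C) (N : ℕ), rank (𝟙 X) < N →
      Ψ.app X = ∑ i ∈ Finset.range N, (Φ i).app X := by
  -- The sum is finite at each object, because layers above the rank of its identity vanish.
  -- Naturality then uses one bound valid for both objects.
  have h0 : ∀ (X : C) (i : ℕ), rank (𝟙 X) < i → (Φ i).app X = 0 := by
    intro X i h
    rw [← hΦ i, NatTrans.comp_app, layerMap_app, layer_eq_zero h, map_zero, zero_comp]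
  have hs : ∀ (X : C) (N : ℕ), rank (𝟙 X) < N → ∑ i ∈ Finset.range (rank (𝟙 X) + 1), (Φ i).app X =
      ∑ i ∈ Finset.range N, (Φ i).app X := by
    intro X N hN
    refine Finset.sum_subset (Finset.range_mono hN) fun i _ hi => h0 X i ?_
    simpa using hi
  refine ⟨{ app := fun X => ∑ i ∈ Finset.range (rank (𝟙 X) + 1), (Φ i).app X
            naturality := fun X Y f => ?_ }, hs⟩
  have hX := hs X (max (rank (𝟙 X)) (rank (𝟙 Y)) + 1) (by omega)
  have hY := hs Y (max (rank (𝟙 X)) (rank (𝟙 Y)) + 1) (by omega)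
  rw [hX, hY, Preadditive.comp_sum, Preadditive.sum_comp]
  exact Finset.sum_congr rfl fun i _ => (Φ i).naturality f

variable (G H) in
/-- The average of a linear map over the automorphisms of `std n`, projected to rank `n`. -/
noncomputable def average [Fintype (std (C := C) n ≅ std n)]
    (r : G.obj (std n) ⟶ H.obj (std n)) : G.obj (std n) ⟶ H.obj (std n) :=
  act G _ _ (layer K n (std n)) ≫
    (∑ g : std (C := C) n ≅ std n, G.map g.inv ≫ r ≫ H.map g.hom) ≫
    act H _ _ (layer K n (std n))

/-- Modulo lower rank, which the layer kills, an endomorphism of `std n` is a combination of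
automorphisms, and a sum over all conjugates commutes with each of these. -/
lemma average_comm [Fintype (std (C := C) n ≅ std n)] (r : G.obj (std n) ⟶ H.obj (std n))
    (a : LHom K (std n) (std n)) :
    act G _ _ a ≫ average G H r = average G H r ≫ act H _ _ a := by
  have h1 : a ≫ layer K n (std n) =
      (∑ g : std (C := C) n ≅ std n, coef K g.hom a • sg K g.hom) ≫ layer K n (std n) := by
    rw [← sub_eq_zero, ← Preadditive.sub_comp]
    exact comp_layer_eq_zero (sub_sum_iso_mem_lowRank a)
  have h2 : layer K n (std n) ≫ a =
      layer K n (std n) ≫ (∑ g : std (C := C) n ≅ std n, coef K g.hom a • sg K g.hom) := by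
    rw [layer_natural, h1, ← layer_natural]
  have e (h : std (C := C) n ≅ std n) :
      G.map h.hom ≫ (∑ g : std (C := C) n ≅ std n, G.map g.inv ≫ r ≫ H.map g.hom) =
        (∑ g : std (C := C) n ≅ std n, G.map g.inv ≫ r ≫ H.map g.hom) ≫ H.map h.hom := by
    rw [Preadditive.comp_sum, Preadditive.sum_comp]
    refine Fintype.sum_equiv ⟨fun g => g ≪≫ h.symm, fun g => g ≪≫ h, fun g => by simp,
      fun g => by simp⟩ _ _ fun g => ?_
    simp
  unfold average
  generalize (∑ g : std (C := C) n ≅ std n, G.map g.inv ≫ r ≫ H.map g.hom) = S at e ⊢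
  have key (h : std (C := C) n ≅ std n) :
      act G _ _ (sg K h.hom ≫ layer K n (std n)) ≫ S ≫ act H _ _ (layer K n (std n)) =
      act G _ _ (layer K n (std n)) ≫ S ≫ act H _ _ (layer K n (std n) ≫ sg K h.hom) := by
    have e1 : act G _ _ (sg K h.hom ≫ layer K n (std n)) =
        act G _ _ (layer K n (std n)) ≫ G.map h.hom := by
      rw [← layer_natural, act_comp, act_sg]
    have e2 : act H _ _ (layer K n (std n) ≫ sg K h.hom) =
        H.map h.hom ≫ act H _ _ (layer K n (std n)) := by
      rw [layer_natural, act_comp, act_sg]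
    rw [e1, e2, Category.assoc, ← Category.assoc (G.map _), e, Category.assoc]
  rw [← Category.assoc, ← act_comp, h1]
  simp only [Category.assoc]
  rw [← act_comp H, h2, Preadditive.sum_comp, Preadditive.comp_sum, map_sum, map_sum,
    Preadditive.sum_comp, Preadditive.comp_sum, Preadditive.comp_sum]
  refine Finset.sum_congr rfl fun h _ => ?_
  rw [Linear.smul_comp, Linear.comp_smul, map_smul, map_smul, Linear.smul_comp, Linear.comp_smul,
    Linear.comp_smul, key]

lemma layer_average [Fintype (std (C := C) n ≅ std n)] (r : G.obj (std n) ⟶ H.obj (std n)) :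
    act G _ _ (layer K n (std n)) ≫ average G H r = average G H r := by
  rw [average, ← Category.assoc, ← act_comp, layer_comp_layer]

end Functors

lemma hom_sum_apply {K : Type*} [Ring K] {M N : ModuleCat.{t} K} {ι : Type*} (s : Finset ι)
    (f : ι → (M ⟶ N)) (x : M) : (∑ i ∈ s, f i) x = ∑ i ∈ s, f i x := by
  change (∑ i ∈ s, f i).hom x = _
  rw [ModuleCat.hom_sum, LinearMap.sum_apply]

/-! ### A cover, Higman's criterion, and injectivity of projectives. -/

section Cover

variable {K : Type v} [Field K] {C : Type w} [Category.{u} C] [RankedCategory C]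

/-- The generators of the standard projective cover of `P`. -/
def CoverGen (P : C ⥤ ModuleCat.{max u v} K) (X : C) : Type (max u v) :=
  Σ m : ℕ, (std m ⟶ X) × P.obj (std m)

/-- A sum of standard projective functors that maps onto `P`. -/
noncomputable def cover (P : C ⥤ ModuleCat.{max u v} K) : C ⥤ ModuleCat.{max u v} K where
  obj X := ModuleCat.of K (CoverGen P X →₀ K)
  map f := ModuleCat.ofHom
    (Finsupp.lmapDomain K K fun q : CoverGen P _ => ⟨q.1, q.2.1 ≫ f, q.2.2⟩)
  map_id X := by
    refine ModuleCat.hom_ext (Finsupp.lhom_ext' fun q => LinearMap.ext_ring ?_)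
    exact Finsupp.mapDomain_single.trans (by rw [Category.comp_id]; rfl)
  map_comp f g := by
    refine ModuleCat.hom_ext (Finsupp.lhom_ext' fun q => LinearMap.ext_ring ?_)
    refine Finsupp.mapDomain_single.trans (Eq.symm ?_)
    refine (congrArg (Finsupp.mapDomain _) Finsupp.mapDomain_single).trans ?_
    exact Finsupp.mapDomain_single.trans (by rw [Category.assoc])

variable {P : C ⥤ ModuleCat.{max u v} K}

/-- The generator of the standard cover with the given components. -/
noncomputable def coverGen {X : C} {m : ℕ} (a : std m ⟶ X) (s : P.obj (std m)) :
    (cover P).obj X :=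
  Finsupp.single (⟨m, a, s⟩ : CoverGen P X) (1 : K)

lemma cover_map_coverGen {X Y : C} (f : X ⟶ Y) {m : ℕ} (a : std m ⟶ X) (s : P.obj (std m)) :
    (cover P).map f (coverGen a s) = coverGen (a ≫ f) s :=
  Finsupp.mapDomain_single

lemma cover_hom_ext {X : C} {M : ModuleCat.{max u v} K} {φ ψ : (cover P).obj X ⟶ M}
    (h : ∀ (m : ℕ) (a : std m ⟶ X) (s : P.obj (std m)), φ (coverGen a s) = ψ (coverGen a s)) :
    φ = ψ := by
  refine ModuleCat.hom_ext (Finsupp.lhom_ext' fun q => LinearMap.ext_ring ?_)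
  exact h q.1 q.2.1 q.2.2

/-- The map out of the standard cover with given values on generators. -/
noncomputable def coverDesc {X : C} {M : ModuleCat.{max u v} K} (φ : CoverGen P X → M) :
    (cover P).obj X ⟶ M :=
  ModuleCat.ofHom (Finsupp.linearCombination K φ)

lemma coverDesc_coverGen {X : C} {M : ModuleCat.{max u v} K} (φ : CoverGen P X → M) {m : ℕ}
    (a : std m ⟶ X) (s : P.obj (std m)) : coverDesc φ (coverGen a s) = φ ⟨m, a, s⟩ :=
  (Finsupp.linearCombination_single K (1 : K) _).trans (one_smul _ _)

variable [∀ X Y : C, Finite (X ⟶ Y)] [SeparatesHoms K C]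

variable (P) in
/-- The standard cover of `P`, which maps the part generated in dimension `m` to the rank `m`
part of `P`. -/
noncomputable def coverMap : cover P ⟶ P where
  app X := coverDesc fun q => act P _ _ (layer K q.1 (std q.1) ≫ sg K q.2.1) q.2.2
  naturality X Y f := by
    refine cover_hom_ext fun m a s => ?_
    rw [ModuleCat.comp_apply, ModuleCat.comp_apply, cover_map_coverGen, coverDesc_coverGen,
      coverDesc_coverGen, ← ModuleCat.comp_apply, ← act_sg P f, ← act_comp, Category.assoc,
      ← sg_comp]

lemma coverMap_coverGen {X : C} {m : ℕ} (a : std m ⟶ X) (s : P.obj (std m)) :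
    (coverMap P).app X (coverGen a s) = act P _ _ (layer K m (std m) ≫ sg K a) s :=
  coverDesc_coverGen _ a s

/-- An element is the sum of its layers, and the rank `m` layer factors through `std m`, which puts
it in the span of images of generators. -/
lemma coverMap_surjective (X : C) : Function.Surjective ((coverMap P).app X) := by
  suffices h : LinearMap.range ((coverMap P).app X).hom = ⊤ from LinearMap.range_eq_top.1 h
  have h1 : ∀ (m : ℕ) (x : LHom K (std m) X) (s : P.obj (std m)),
      act P _ _ (layer K m (std m) ≫ x) s ∈ LinearMap.range ((coverMap P).app X).hom := by
    intro m x s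
    induction x using lhom_induction with
    | zero => simp
    | add x y hx hy =>
      rw [Preadditive.comp_add, map_add]
      exact add_mem hx hy
    | smul_sg c f =>
      rw [Linear.comp_smul, map_smul]
      refine Submodule.smul_mem _ c ?_
      exact ⟨coverGen f s, coverMap_coverGen f s⟩
  rw [eq_top_iff]
  intro s _
  have hs : s = ∑ m ∈ Finset.range (rank (𝟙 X) + 1), act P _ _ (layer K m X) s := by
    have := congrArg (fun z => act P X X z s) (sum_layer (K := K) (rank (𝟙 X) + 1) (Nat.lt_succ_self _))
    simp only [map_sum, act_id] at this
    simpa [hom_sum_apply] using this.symm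
  rw [hs]
  refine Submodule.sum_mem _ fun m _ => ?_
  have := Fintype.ofFinite (X ⟶ std (C := C) m)
  obtain ⟨x, hx⟩ := exists_layer_eq_sum K m X
  have hl : layer K m X = ∑ b, sg K b ≫ layer K m _ ≫ x b := by
    rw [← layer_comp_layer]
    nth_rewrite 2 [hx]
    rw [Preadditive.comp_sum]
    refine Finset.sum_congr rfl fun b _ => ?_
    rw [← Category.assoc, layer_natural, Category.assoc]
  rw [hl, map_sum, hom_sum_apply]
  refine Submodule.sum_mem _ fun b _ => ?_
  rw [act_comp]
  exact h1 m _ _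

open Classical in
/-- **Higman's criterion**: on the rank `n` part of a projective functor, the identity is an
average of a linear map. -/
lemma exists_average_eq (hP : Projective P) (n : ℕ) [Fintype (std (C := C) n ≅ std n)] :
    ∃ r : P.obj (std n) ⟶ P.obj (std n), act P _ _ (layer K n (std n)) = average P P r := by
  have : Epi (coverMap P) := by
    have : ∀ X, Epi ((coverMap P).app X) := fun X =>
      (ModuleCat.epi_iff_surjective _).2 (coverMap_surjective X)
    exact NatTrans.epi_of_epi_app _
  let σ := Projective.factorThru (𝟙 P) (coverMap P)
  have hσ : σ ≫ coverMap P = 𝟙 P := Projective.factorThru_comp _ _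
  -- `τ` reads off the component at the identity of `std n`. Its sum of conjugates sends the
  -- generator at an automorphism `a` to the action of `a`. Generators at non-invertible `a`, or
  -- from another rank, go to zero, in agreement with `coverMap` followed by the layer.
  let τ : (cover P).obj (std n) ⟶ P.obj (std n) := coverDesc fun q =>
    if h : q.1 = n then (if q.2.1 = eqToHom (by rw [h]) then P.map (eqToHom (by rw [h])) q.2.2 else 0)
    else 0
  have hτ : ∀ (a : std (C := C) n ⟶ std n) s, τ (coverGen a s) = if a = 𝟙 _ then s else 0 := by
    intro a s
    simp [τ, coverDesc_coverGen]
  have hτ' : ∀ m, m ≠ n → ∀ (a : std (C := C) m ⟶ std n) s, τ (coverGen a s) = 0 := by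
    intro m h a s
    simp [τ, coverDesc_coverGen, h]
  have key : (coverMap P).app (std n) ≫ act P _ _ (layer K n (std n)) =
      (∑ g : std (C := C) n ≅ std n, (cover P).map g.inv ≫ τ ≫ P.map g.hom) ≫
        act P _ _ (layer K n (std n)) := by
    refine cover_hom_ext fun m a s => ?_
    rw [ModuleCat.comp_apply, coverMap_coverGen, ← ModuleCat.comp_apply, ← act_comp,
      ModuleCat.comp_apply, hom_sum_apply]
    simp only [ModuleCat.hom_comp, LinearMap.comp_apply, cover_map_coverGen]
    by_cases hm : m = n
    · subst hm
      simp only [hτ]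
      by_cases ha : IsIso a
      · rw [Finset.sum_eq_single (asIso a)]
        · rw [if_pos (by simp), Category.assoc, ← layer_natural, layer_comp_layer_assoc,
            layer_natural, act_comp, act_sg]
          rfl
        · intro g _ hg
          rw [if_neg, map_zero]
          intro h
          rw [Iso.comp_inv_eq, Category.id_comp] at h
          exact hg (Iso.ext h.symm)
        · simp
      · rw [Finset.sum_eq_zero, map_zero]
        · have hlow : sg K a ∈ lowRank K m _ _ :=
            sg_mem_lowRank ((rank_le_of_to_std a).lt_of_ne fun h => ha (isIso_of_rank_eq a h))
          rw [layer_comp_eq_zero hlow]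
          simp
        · intro g _
          rw [if_neg, map_zero]
          intro h
          rw [Iso.comp_inv_eq, Category.id_comp] at h
          exact ha (h ▸ inferInstance)
    · simp only [hτ' m hm, map_zero, Finset.sum_const_zero]
      rw [Category.assoc, ← layer_natural, ← Category.assoc, layer_comp_layer_of_ne hm]
      simp
  refine ⟨σ.app (std n) ≫ τ, ?_⟩
  have h1 : σ.app (std n) ≫ (coverMap P).app (std n) = 𝟙 _ := by
    rw [← NatTrans.comp_app, hσ, NatTrans.id_app]
  calc act P _ _ (layer K n (std n))
      = act P _ _ (layer K n (std n)) ≫ σ.app (std n) ≫ (coverMap P).app (std n) ≫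
          act P _ _ (layer K n (std n)) := by
        rw [← Category.assoc (σ.app _), h1, Category.id_comp, ← act_comp, layer_comp_layer]
    _ = average P P (σ.app (std n) ≫ τ) := by
        rw [key, average, ← Category.assoc (σ.app _), Preadditive.comp_sum]
        congr 2
        refine Finset.sum_congr rfl fun g _ => ?_
        rw [← Category.assoc, ← σ.naturality, Category.assoc, Category.assoc]

/-- In each rank, take a `K`-linear retraction `r` of `i` at `std n` and a map `u` whose average is
the layer. The average of `r ≫ f ≫ u` is equivariant, and naturality of `i` and `f` brings its
restriction along `i` back to the rank `n` part of `f`. The extensions are then summed over ranks.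
-/
theorem injective_of_projective (hP : Projective P) : Injective P where
  factors {X Y} f i _ := by
    have := fun n => Fintype.ofFinite (std (C := C) n ≅ std n)
    have hi : ∀ Z, Function.Injective (i.app Z) := fun Z =>
      (ModuleCat.mono_iff_injective _).1 inferInstance
    have step : ∀ n, ∃ Φ : Y ⟶ P, layerMap n Y ≫ Φ = Φ ∧ i ≫ Φ = layerMap n X ≫ f := by
      intro n
      obtain ⟨u, hu⟩ := exists_average_eq hP n
      obtain ⟨r, hr⟩ := LinearMap.exists_leftInverse_of_injective (i.app (std n)).hom
        (LinearMap.ker_eq_bot.2 (hi (std n)))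
      have hr' : i.app (std n) ≫ ModuleCat.ofHom r = 𝟙 _ := ModuleCat.hom_ext hr
      obtain ⟨Φ, hΦ, hΦ'⟩ := exists_natTrans (average Y P (ModuleCat.ofHom r ≫ f.app (std n) ≫ u))
        (average_comm _) (layer_average _)
      refine ⟨Φ, hΦ', natTrans_ext_of_layerMap (n := n) ?_ ?_ ?_⟩
      · rw [← Category.assoc, layerMap_naturality, Category.assoc, hΦ']
      · rw [← Category.assoc, layerMap_idem]
      · rw [NatTrans.comp_app, NatTrans.comp_app, hΦ, layerMap_app]
        calc i.app (std n) ≫ average Y P (ModuleCat.ofHom r ≫ f.app (std n) ≫ u)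
            = act X _ _ (layer K n (std n)) ≫ f.app (std n) ≫
              (∑ g : std (C := C) n ≅ std n, P.map g.inv ≫ u ≫ P.map g.hom) ≫
                act P _ _ (layer K n (std n)) := by
              rw [average, ← Category.assoc, ← act_naturality, Category.assoc]
              congr 1
              rw [← Category.assoc, ← Category.assoc (f.app _), Preadditive.comp_sum,
                Preadditive.comp_sum]
              congr 1
              refine Finset.sum_congr rfl fun g _ => ?_
              rw [← Category.assoc, ← i.naturality, Category.assoc, Category.assoc,
                ← Category.assoc (i.app _), hr', Category.id_comp, Category.assoc,
                f.naturality_assoc]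
          _ = f.app (std n) ≫ act P _ _ (layer K n (std n)) := by
              rw [← Category.assoc, act_naturality, Category.assoc]
              conv_rhs => rw [hu, average]
          _ = act X _ _ (layer K n (std n)) ≫ f.app (std n) := (act_naturality _ _).symm
    choose Φ hΦ hΦ' using step
    obtain ⟨Ψ, hΨ⟩ := exists_natTrans_sum Φ hΦ
    refine ⟨Ψ, ?_⟩
    ext Z : 2
    have hN := Nat.lt_succ_self (rank (𝟙 Z))
    rw [NatTrans.comp_app, hΨ Z _ hN, Preadditive.comp_sum]
    have : ∀ n, i.app Z ≫ (Φ n).app Z = act X _ _ (layer K n Z) ≫ f.app Z := by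
      intro n
      rw [← NatTrans.comp_app, hΦ', NatTrans.comp_app, layerMap_app]
    simp only [this]
    rw [← Preadditive.sum_comp, ← map_sum, sum_layer _ hN, act_id, Category.id_comp]

end Cover

/-! ### Indecomposable objects and composition series in abelian categories. -/

section Abelian

variable {A : Type w} [Category.{t} A] [Abelian A]

/-- An idempotent endomorphism of an indecomposable object is trivial. -/
lemma idempotent_eq_zero_or_id {X : A} (hX : Indecomposable X) (e : X ⟶ X) (he : e ≫ e = e) :
    e = 0 ∨ e = 𝟙 X := by
  have he' : (𝟙 X - e) ≫ e = 0 := by rw [Preadditive.sub_comp, he, Category.id_comp, sub_self]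
  have he'' : e ≫ (𝟙 X - e) = 0 := by rw [Preadditive.comp_sub, he, Category.comp_id, sub_self]
  let b : BinaryBicone (kernel e) (kernel (𝟙 X - e)) :=
    { pt := X
      fst := kernel.lift e (𝟙 X - e) he'
      snd := kernel.lift (𝟙 X - e) e he''
      inl := kernel.ι e
      inr := kernel.ι (𝟙 X - e)
      inl_fst := by
        rw [← cancel_mono (kernel.ι e)]
        simp [Preadditive.comp_sub]
      inl_snd := by
        rw [← cancel_mono (kernel.ι (𝟙 X - e))]
        simp
      inr_fst := by
        rw [← cancel_mono (kernel.ι e)]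
        simpa using kernel.condition (𝟙 X - e)
      inr_snd := by
        rw [← cancel_mono (kernel.ι (𝟙 X - e))]
        have := kernel.condition (𝟙 X - e)
        rw [Preadditive.comp_sub, sub_eq_zero, Category.comp_id] at this
        simpa using this.symm }
  have hb : b.IsBilimit := isBinaryBilimitOfTotal b (by simp [b])
  rcases hX.2 _ _ (biprod.uniqueUpToIso _ _ hb) with h | h
  · right
    have h1 : 𝟙 X - e = kernel.lift e (𝟙 X - e) he' ≫ kernel.ι e := by simp
    rw [h.eq_zero_of_src (kernel.ι e), comp_zero, sub_eq_zero] at h1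
    exact h1.symm
  · left
    have h1 : e = kernel.lift (𝟙 X - e) e he'' ≫ kernel.ι (𝟙 X - e) := by simp
    rwa [h.eq_zero_of_src (kernel.ι (𝟙 X - e)), comp_zero] at h1

/-- The quotient of consecutive subobjects is simple. -/
lemma simple_cokernel_of_covBy {X : A} {s t : Subobject X} (h : s ⋖ t) :
    Simple (cokernel (Subobject.ofLE s t h.le)) := by
  suffices H : ∀ i : (s : A) ⟶ (t : A), i ≫ t.arrow = s.arrow → Simple (cokernel i) from
    H _ (Subobject.ofLE_arrow h.le)
  intro i hi
  have hmono : Mono i := by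
    have : Mono (i ≫ t.arrow) := hi ▸ inferInstance
    exact mono_of_mono i t.arrow
  have hπ : cokernel.π i ≠ 0 := by
    intro h0
    have : Epi i := Preadditive.epi_of_cokernel_zero h0
    have : IsIso i := isIso_of_mono_of_epi i
    exact h.lt.not_ge (Subobject.le_of_comm (inv i) (by rw [IsIso.inv_comp_eq, hi]))
  refine ⟨fun {Y} f hf => ⟨?_, fun hne => ?_⟩⟩
  · rintro hiso rfl
    apply hπ
    rw [← Category.comp_id (cokernel.π i), ← IsIso.inv_hom_id (0 : Y ⟶ cokernel i), comp_zero,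
      comp_zero]
  -- A subobject `f` of the cokernel pulls back to `q` with `s ≤ q ≤ t`. By covering, `q = s`, which
  -- makes `f` zero, or `q = t`, which makes `f` epi.
  · obtain ⟨q, hq'⟩ : ∃ q, q = pullback.snd f (cokernel.π i) ≫ t.arrow := ⟨_, rfl⟩
    have hmq : Mono q := hq' ▸ mono_comp _ _
    have hq : Subobject.mk q ≤ t := Subobject.mk_le_of_comm (pullback.snd _ _) hq'.symm
    have hsq : s ≤ Subobject.mk q :=
      Subobject.le_mk_of_comm (pullback.lift 0 i (by simp)) (by
        rw [hq', ← Category.assoc, pullback.lift_snd, hi])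
    have hqa : (Subobject.underlyingIso q).inv ≫ (Subobject.mk q).arrow = q :=
      Subobject.underlyingIso_arrow q
    rcases h.eq_or_eq hsq hq with heq | heq
    · exfalso
      apply hne
      have h1 : pullback.snd f (cokernel.π i) ≫ cokernel.π i = 0 := by
        have h2 : pullback.snd f (cokernel.π i) =
            (Subobject.underlyingIso q).inv ≫ Subobject.ofLE _ _ heq.le ≫ i := by
          rw [← cancel_mono t.arrow, ← hq', Category.assoc, Category.assoc, hi,
            Subobject.ofLE_arrow, hqa]
        rw [h2]
        simp
      rw [← pullback.condition] at h1
      exact zero_of_epi_comp _ h1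
    · have hs : Epi (pullback.snd f (cokernel.π i)) := by
        have h2 : (Subobject.ofLE _ _ heq.ge ≫ (Subobject.underlyingIso q).hom) ≫
            pullback.snd f (cokernel.π i) = 𝟙 _ := by
          rw [← cancel_mono t.arrow, Category.assoc, Category.assoc, ← hq', Category.id_comp,
            ← (Iso.inv_comp_eq _).1 hqa, Subobject.ofLE_arrow]
        exact (IsSplitEpi.mk' ⟨_, h2⟩ : IsSplitEpi _).epi
      have : Epi (pullback.snd f (cokernel.π i) ≫ cokernel.π i) := epi_comp _ _
      rw [← pullback.condition] at this
      have : Epi f := epi_of_epi (pullback.fst f (cokernel.π i)) f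
      exact isIso_of_mono_of_epi f

lemma hasFinitelyManyCompositionFactors_of_wellFounded (X : A) [WellFoundedLT (Subobject X)]
    [WellFoundedGT (Subobject X)] : HasFinitelyManyCompositionFactors X := by
  obtain ⟨a, h0, n, hn, ha⟩ :=
    exists_covBy_seq_of_wellFoundedLT_wellFoundedGT (Subobject X)
  refine ⟨n, ⟨fun i => a i, ?_⟩, h0.eq_bot, hn.eq_top, fun i => ?_⟩
  · refine Fin.monotone_iff_le_succ.2 fun i => ?_
    exact (ha i i.2).le
  · exact simple_cokernel_of_covBy (ha i i.2)

end Abelian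

/-! ### Idempotents from endomorphisms of finite rank. -/

section LinearAlgebra

/-- The algebra generated by an endomorphism of finite rank with a nonzero fixed vector contains a
nonzero idempotent, which is the identity only if the space is finite dimensional. -/
lemma exists_idempotent_of_finite_range {K M : Type*} [Field K] [AddCommGroup M] [Module K M]
    (h : Module.End K M) [Module.Finite K (LinearMap.range h)] {x : M} (hx : h x = x)
    (hx0 : x ≠ 0) : ∃ e ∈ Algebra.adjoin K {h}, e * e = e ∧ e ≠ 0 ∧
      (e = 1 → Module.Finite K M) := by
  have hint : IsIntegral K h := by
    -- If a monic `q` annihilates `h` on its finite-dimensional range, then `q * X` annihilates `h`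
    -- on all of `M`.
    let h' : Module.End K (LinearMap.range h) := h.restrict fun x _ => ⟨x, rfl⟩
    obtain ⟨q, hq, hq0⟩ := (Algebra.IsIntegral.isIntegral (R := K) h')
    refine ⟨q * Polynomial.X, hq.mul Polynomial.monic_X, ?_⟩
    rw [← Polynomial.aeval_def] at hq0 ⊢
    have key : ∀ (p : Polynomial K) (y : LinearMap.range h),
        (Polynomial.aeval h p) y.1 = ((Polynomial.aeval h' p) y).1 := by
      intro p
      induction p using Polynomial.induction_on' with
      | add p q hp hq => intro y; simp [hp, hq]
      | monomial k c =>
        intro y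
        have hk : ∀ k : ℕ, (h ^ k) y.1 = ((h' ^ k) y).1 := by
          intro k
          induction k with
          | zero => rfl
          | succ k ih =>
            rw [pow_succ', pow_succ', Module.End.mul_apply, Module.End.mul_apply, ih]
            rfl
        simp [Polynomial.aeval_monomial, hk, Module.algebraMap_end_apply]
    ext y
    have := key q ⟨h y, y, rfl⟩
    rw [hq0] at this
    simpa using this
  let B := Algebra.adjoin K {h}
  have : Module.Finite K B := Module.Finite.iff_fg.2 hint.fg_adjoin_singleton
  have : IsMulCommutative B := Algebra.isMulCommutative_adjoin K (by simp)
  let _ : CommRing B := inferInstance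
  have : IsArtinianRing B := IsArtinianRing.of_finite K B
  let b : B := ⟨h, Algebra.self_mem_adjoin_singleton K h⟩
  -- Fitting's argument: the powers of `b` stabilize, `b ^ (n + 1) * y = b ^ n`, so `b ^ n * y ^ n`
  -- is idempotent. It is nonzero because `h ^ n` fixes `x`; if it is `1`, then `h` is onto and `M`
  -- is its finite-dimensional range.
  obtain ⟨n, y, hy⟩ := IsArtinian.exists_pow_succ_smul_dvd b (1 : B)
  simp only [smul_eq_mul, mul_one] at hy
  have hpow : ∀ k, b ^ (n + k) * y ^ k = b ^ n := by
    intro k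
    induction k with
    | zero => simp
    | succ k ih =>
      calc b ^ (n + (k + 1)) * y ^ (k + 1) = (b ^ n.succ * y) * (b ^ k * y ^ k) := by
            rw [Nat.succ_eq_add_one]; ring
        _ = b ^ (n + k) * y ^ k := by rw [hy]; ring
        _ = b ^ n := ih
  refine ⟨(b ^ n * y ^ n : B), (b ^ n * y ^ n : B).2, ?_, ?_, ?_⟩
  · have : (b ^ n * y ^ n) * (b ^ n * y ^ n) = b ^ n * y ^ n := by
      calc (b ^ n * y ^ n) * (b ^ n * y ^ n) = (b ^ (n + n) * y ^ n) * y ^ n := by ring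
        _ = _ := by rw [hpow]
    exact congrArg Subtype.val this
  · intro h0
    have h1 : b ^ n * y ^ n = 0 := Subtype.ext h0
    have h2 : b ^ n = 0 := by
      rw [← hpow n, pow_add, mul_assoc, h1, mul_zero]
    have h3 : (h ^ n) x = 0 := by
      have : h ^ n = 0 := congrArg Subtype.val h2
      rw [this]; rfl
    have h4 : (h ^ n) x = x := by
      clear * - hx
      induction n with
      | zero => rfl
      | succ n ih => rw [pow_succ, Module.End.mul_apply, hx, ih]
    exact hx0 (h4 ▸ h3)
  · intro h1
    have h1 : b ^ n * y ^ n = 1 := Subtype.ext h1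
    have h2 : b * (y * (b ^ n * y ^ n)) = 1 := by
      rw [← h1]
      calc b * (y * (b ^ n * y ^ n)) = (b ^ n.succ * y) * y ^ n := by
            rw [Nat.succ_eq_add_one]; ring
        _ = _ := by rw [hy]
    have h3 : LinearMap.range h = ⊤ := by
      rw [LinearMap.range_eq_top]
      intro m
      exact ⟨(y * (b ^ n * y ^ n) : B).1 m, LinearMap.congr_fun (congrArg Subtype.val h2) m⟩
    exact Module.Finite.equiv (LinearEquiv.ofTop _ h3)

end LinearAlgebra

/-! ### Finite length of indecomposable projectives. -/

section FiniteLength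

variable {K : Type v} [Field K] {C : Type w} [Category.{u} C] [RankedCategory C]
  [∀ X Y : C, Finite (X ⟶ Y)] [SeparatesHoms K C] {n : ℕ}

/-- An indecomposable functor is concentrated in a single rank. -/
lemma exists_layerMap_eq_id {G : C ⥤ ModuleCat.{t} K} (hG : Indecomposable G) :
    ∃ n, layerMap n G = 𝟙 G := by
  by_contra! hne
  refine hG.1 ((IsZero.iff_id_eq_zero G).2 ?_)
  have h0 : ∀ n, layerMap n G = 0 := fun n =>
    (idempotent_eq_zero_or_id hG _ layerMap_idem).resolve_right (hne n)
  ext X : 2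
  have h1 : ∀ n, act G X X (layer K n X) = 0 := fun n => by
    rw [← layerMap_app, h0]
    rfl
  rw [NatTrans.id_app, ← act_id, ← sum_layer _ (Nat.lt_succ_self (rank (𝟙 X))), map_sum]
  simp [h1]

lemma act_layer_eq_id {G : C ⥤ ModuleCat.{t} K} (hG : layerMap n G = 𝟙 G) (X : C) :
    act G X X (layer K n X) = 𝟙 _ := by
  rw [← layerMap_app, hG, NatTrans.id_app]

/-- A functor concentrated in rank `n` vanishes if its value at `std n` does. -/
lemma isZero_of_layerMap_eq_id {G : C ⥤ ModuleCat.{t} K} (hG : layerMap n G = 𝟙 G)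
    (h : 𝟙 (G.obj (std n)) = 0) : IsZero G := by
  rw [IsZero.iff_id_eq_zero]
  exact natTrans_ext_of_layerMap (n := n) (by simp [hG]) (by simp) h

/-- A subobject of a functor concentrated in rank `n` is determined by its value at `std n`. -/
noncomputable def subobjectEmbedding {G : C ⥤ ModuleCat.{t} K} (hG : layerMap n G = 𝟙 G) :
    Subobject G ↪o Submodule K (G.obj (std n)) :=
  OrderEmbedding.ofMapLEIff
    (fun N => LinearMap.range (N.arrow.app (std n)).hom) (by
      intro N N'
      constructor
      · intro h
        -- The composite `N ⟶ G ⟶ G / N'` is supported in rank `n`, so its vanishing at `std n` is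
        -- enough.
        have hzero : N.arrow ≫ cokernel.π N'.arrow = 0 := by
          have hψ : layerMap n (N : C ⥤ ModuleCat.{t} K) ≫ N.arrow ≫ cokernel.π N'.arrow =
              N.arrow ≫ cokernel.π N'.arrow := by
            rw [← Category.assoc, layerMap_naturality, hG, Category.comp_id]
          refine natTrans_ext_of_layerMap hψ (by simp) ?_
          ext x
          obtain ⟨y, hy⟩ := h ⟨x, rfl⟩
          have h0 : N'.arrow.app (std n) ≫ (cokernel.π N'.arrow).app (std n) = 0 := by
            rw [← NatTrans.comp_app, cokernel.condition]
            rfl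
          have h1 := ConcreteCategory.congr_hom h0 y
          rw [ModuleCat.comp_apply] at h1
          rw [NatTrans.comp_app, ModuleCat.hom_comp, LinearMap.comp_apply, ← hy]
          exact h1
        exact Subobject.le_of_comm (Abelian.monoLift N'.arrow N.arrow hzero)
          (Abelian.monoLift_comp _ _ _)
      · intro h
        rintro _ ⟨x, rfl⟩
        refine ⟨(Subobject.ofLE N N' h).app (std n) x, ?_⟩
        change (((Subobject.ofLE N N' h).app (std n)) ≫ N'.arrow.app (std n)) x = _
        rw [← NatTrans.comp_app, Subobject.ofLE_arrow])

variable {P : C ⥤ ModuleCat.{max u v} K}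

/-- An average of maps of finite rank which fixes a nonzero vector. -/
lemma exists_finite_range_endomorphism (hP : Projective P) (hn : layerMap n P = 𝟙 P)
    (x : P.obj (std n)) : ∃ h : P.obj (std n) ⟶ P.obj (std n),
      (∀ a, act P _ _ a ≫ h = h ≫ act P _ _ a) ∧ Module.Finite K (LinearMap.range h.hom) ∧
      h x = x := by
  have := Fintype.ofFinite (std (C := C) n ≅ std n)
  obtain ⟨u, hu⟩ := exists_average_eq hP n
  let S : Submodule K (P.obj (std n)) :=
    Submodule.span K (Set.range fun g : std (C := C) n ≅ std n => P.map g.hom x)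
  have hSfin : Module.Finite K S := Module.Finite.span_of_finite K (Set.finite_range _)
  obtain ⟨r, hr⟩ := LinearMap.exists_leftInverse_of_injective S.subtype S.ker_subtype
  have havg : ∀ w : P.obj (std n) ⟶ P.obj (std n), average P P w =
      ∑ g : std (C := C) n ≅ std n, P.map g.inv ≫ w ≫ P.map g.hom := by
    intro w
    rw [average, act_layer_eq_id hn]
    simp
  -- Projecting to the span `S` of the orbit of `x` before applying `u` makes the rank finite. On
  -- the orbit nothing changes, so the average of `w` still fixes `x`.
  let w : P.obj (std n) ⟶ P.obj (std n) := ModuleCat.ofHom (S.subtype ∘ₗ r) ≫ u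
  refine ⟨average P P w, average_comm w, ?_, ?_⟩
  · let a : ((std (C := C) n ≅ std n) → S) →ₗ[K] P.obj (std n) :=
      ∑ g : std (C := C) n ≅ std n,
        (P.map g.hom).hom ∘ₗ u.hom ∘ₗ S.subtype ∘ₗ LinearMap.proj g
    refine Submodule.finiteDimensional_of_le (S₂ := LinearMap.range a) ?_
    rintro _ ⟨y, rfl⟩
    refine ⟨fun g => r (P.map g.inv y), ?_⟩
    change _ = average P P w y
    rw [havg, hom_sum_apply]
    simp [a, w]
  · have hfix : ∀ g : std (C := C) n ≅ std n, (P.map g.inv ≫ w ≫ P.map g.hom) x =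
        (P.map g.inv ≫ u ≫ P.map g.hom) x := by
      intro g
      have hmem : P.map g.inv x ∈ S := Submodule.subset_span ⟨g.symm, rfl⟩
      have := congrArg Subtype.val (LinearMap.congr_fun hr ⟨_, hmem⟩)
      simp only [LinearMap.comp_apply, Submodule.subtype_apply, LinearMap.id_apply] at this
      simp [w, this]
    rw [havg, hom_sum_apply, Finset.sum_congr rfl fun g _ => hfix g, ← hom_sum_apply, ← havg,
      ← hu, act_layer_eq_id hn]
    rfl

/-- The value at `std n` of an indecomposable projective functor concentrated in rank `n` is
finite dimensional. -/
lemma finite_obj_std (hP : Projective P) (hI : Indecomposable P) (hn : layerMap n P = 𝟙 P) :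
    Module.Finite K (P.obj (std n)) := by
  obtain ⟨x, hx⟩ : ∃ x : P.obj (std n), x ≠ 0 := by
    by_contra! h
    refine hI.1 (isZero_of_layerMap_eq_id hn ?_)
    ext y
    simp [h y]
  obtain ⟨h, hcomm, hfin, hhx⟩ := exists_finite_range_endomorphism hP hn x
  obtain ⟨e, he, hee, he0, he1⟩ := exists_idempotent_of_finite_range h.hom hhx hx
  have hecomm : ∀ a, act P _ _ a ≫ ModuleCat.ofHom e = ModuleCat.ofHom e ≫ act P _ _ a := by
    intro a
    -- `e` lies in the algebra generated by `h`, so it commutes with everything that commutes with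
    -- `h` and extends to an idempotent of `P`, which is `0` or `𝟙` by indecomposability.
    have hmem : e ∈ Subalgebra.centralizer K {(act P (std n) (std n) a).hom} := by
      refine Algebra.adjoin_le (Set.singleton_subset_iff.2 ?_) he
      rw [SetLike.mem_coe, Subalgebra.mem_centralizer_iff]
      rintro _ rfl
      exact (congrArg ModuleCat.Hom.hom (hcomm a)).symm
    rw [Subalgebra.mem_centralizer_iff] at hmem
    exact ModuleCat.hom_ext (hmem _ rfl).symm
  obtain ⟨E, hE, -⟩ := exists_natTrans (ModuleCat.ofHom e) hecomm
    (by rw [act_layer_eq_id hn, Category.id_comp])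
  have hEE : E ≫ E = E := by
    refine natTrans_ext_of_layerMap (n := n) (by simp [hn]) (by simp [hn]) ?_
    rw [NatTrans.comp_app, hE]
    exact ModuleCat.hom_ext hee
  refine he1 ?_
  rcases idempotent_eq_zero_or_id hI E hEE with h0 | h1
  · refine absurd ?_ he0
    rw [h0] at hE
    exact (congrArg ModuleCat.Hom.hom hE).symm
  · rw [h1] at hE
    exact (congrArg ModuleCat.Hom.hom hE).symm

theorem hasFinitelyManyCompositionFactors_of_projective (hP : Projective P)
    (hI : Indecomposable P) : HasFinitelyManyCompositionFactors P := by
  obtain ⟨n, hn⟩ := exists_layerMap_eq_id (K := K) hI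
  have := finite_obj_std hP hI hn
  have h1 : WellFoundedLT (Subobject P) := (subobjectEmbedding hn).wellFoundedLT
  have h2 : WellFoundedGT (Subobject P) := (subobjectEmbedding hn).wellFoundedGT
  exact hasFinitelyManyCompositionFactors_of_wellFounded P

end FiniteLength

/-! ### Radon inversion and separation of morphisms over a finite field. -/

/-- **Inversion of the finite Radon transform**: a function on a finite vector space whose sums
over all affine hyperplanes vanish is zero. -/
lemma eq_zero_of_sum_hyperplane_eq_zero {F K M N : Type*} [Field F] [Fintype F] [DecidableEq F]
    [Field K] [AddCommGroup M] [Module F M] [Fintype M] [AddCommGroup N] [Module F N] [Fintype N]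
    (hN : (Fintype.card N : K) ≠ 0) (B : N →ₗ[F] M →ₗ[F] F)
    (hB : ∀ m, (∀ n, B n m = 0) → m = 0) (x : M → K)
    (h : ∀ n c, ∑ m, (if B n m = c then x m else 0) = 0) : x = 0 := by
  classical
  funext a
  have htot : ∑ m, x m = 0 := by simpa using h 0 0
  -- The hyperplanes `B n m = B n a + 1` all miss `a`, and each other point lies on the same number
  -- of them, `|N| / |F|`. Summing over these gives `∑ m ≠ a, x m = 0`, to be compared with the
  -- total sum, the degenerate case `n = 0`, `c = 0`.
  have hcount : ∀ m, m ≠ a → (Fintype.card F : K) *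
      (Finset.card {n : N | B n m = B n a + 1} : K) = Fintype.card N := by
    intro m hm
    obtain ⟨n₀, hn₀⟩ : ∃ n, B n (m - a) ≠ 0 := by
      by_contra! h0
      exact hm (sub_eq_zero.1 (hB _ h0))
    let l : N →ₗ[F] F := B.flip (m - a)
    have hl : Function.Surjective l := LinearMap.surjective fun h0 =>
      hn₀ (LinearMap.congr_fun h0 n₀)
    have heq : Finset.univ.filter (fun n : N => B n m = B n a + 1) =
        Finset.univ.filter (fun n : N => l n = 1) := by
      ext n
      simp [l, sub_eq_iff_eq_add, add_comm]
    have hfib : ∀ c : F, Finset.card {n : N | l n = c} = Finset.card {n : N | l n = 1} :=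
      fun c => AddMonoidHom.card_fiber_eq_of_mem_range l.toAddMonoidHom (hl c) (hl 1)
    rw [heq]
    have := Finset.card_eq_sum_card_fiberwise (f := l) (s := (Finset.univ : Finset N))
      (t := (Finset.univ : Finset F)) (by simp)
    rw [Finset.sum_congr rfl fun c _ => hfib c, Finset.sum_const, smul_eq_mul, Finset.card_univ,
      Finset.card_univ] at this
    rw [this]
    push_cast
    rfl
  have hsum : ∑ m, (Finset.card {n : N | B n m = B n a + 1} : K) * x m = 0 := by
    calc ∑ m, (Finset.card {n : N | B n m = B n a + 1} : K) * x m
        = ∑ m, ∑ n, (if B n m = B n a + 1 then x m else 0) := by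
          refine Finset.sum_congr rfl fun m _ => ?_
          rw [← Finset.sum_filter, Finset.sum_const, nsmul_eq_mul]
      _ = ∑ n, ∑ m, (if B n m = B n a + 1 then x m else 0) := Finset.sum_comm
      _ = 0 := Finset.sum_eq_zero fun n _ => h n _
  have hrest : ∑ m ∈ Finset.univ.erase a, x m = 0 := by
    have h1 : (Fintype.card N : K) * ∑ m ∈ Finset.univ.erase a, x m = 0 := by
      rw [← mul_zero (Fintype.card F : K), ← hsum, Finset.mul_sum, Finset.mul_sum,
        ← Finset.add_sum_erase _ _ (Finset.mem_univ a)]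
      have h0 : ({n : N | B n a = B n a + 1} : Finset N) = ∅ := by
        ext n
        simp
      rw [h0]
      simp only [Finset.card_empty, Nat.cast_zero, zero_mul, mul_zero, zero_add]
      refine Finset.sum_congr rfl fun m hm => ?_
      rw [← mul_assoc, hcount m (Finset.ne_of_mem_erase hm)]
    exact (mul_eq_zero.1 h1).resolve_left hN
  rw [← Finset.add_sum_erase _ _ (Finset.mem_univ a), hrest, add_zero] at htot
  exact htot

section FiniteField

variable {F : Type u} [Field F]

/-- The linear map underlying a morphism of finite dimensional vector spaces. -/
abbrev toLin {X Y : FGModuleCat.{u} F} (f : X ⟶ Y) : X →ₗ[F] Y := f.hom.hom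

/-- The morphism of finite dimensional vector spaces given by a linear map. -/
abbrev ofLin {X Y : FGModuleCat.{u} F} (f : X →ₗ[F] Y) : X ⟶ Y := ⟨ModuleCat.ofHom f⟩

lemma exists_factorization_of_finrank_range {X Y : FGModuleCat.{u} F} (f : X ⟶ Y) {n : ℕ}
    (h : Module.finrank F (LinearMap.range (toLin f)) = n) :
    ∃ (b : X ⟶ FGModuleCat.of F (Fin n → F)) (a : FGModuleCat.of F (Fin n → F) ⟶ Y),
      b ≫ a = f := by
  let e : LinearMap.range (toLin f) ≃ₗ[F] (Fin n → F) :=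
    LinearEquiv.ofFinrankEq _ _ (by rw [h]; simp)
  refine ⟨ofLin (e.toLinearMap ∘ₗ (toLin f).rangeRestrict),
    ofLin ((LinearMap.range (toLin f)).subtype ∘ₗ e.symm.toLinearMap), ?_⟩
  refine FGModuleCat.hom_ext (LinearMap.ext fun x => ?_)
  change ((e.symm (e ((toLin f).rangeRestrict x)) : LinearMap.range (toLin f)) : Y) = toLin f x
  rw [e.symm_apply_apply]
  rfl

lemma ker_eq_bot_of_finrank_range {Y : FGModuleCat.{u} F} {n : ℕ}
    (f : FGModuleCat.of F (Fin n → F) ⟶ Y)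
    (h : Module.finrank F (LinearMap.range (toLin f)) = n) : LinearMap.ker (toLin f) = ⊥ := by
  have h1 := LinearMap.finrank_range_add_finrank_ker (toLin f)
  have h2 : Module.finrank F (FGModuleCat.of F (Fin n → F)) = n := Module.finrank_fin_fun F
  rw [h, h2] at h1
  exact Submodule.finrank_eq_zero.1 (by omega)

noncomputable instance : RankedCategory (FGModuleCat.{u} F) where
  rank f := Module.finrank F (LinearMap.range (toLin f))
  std n := FGModuleCat.of F (Fin n → F)
  rank_comp_le_left f g := by
    rw [toLin, FGModuleCat.hom_hom_comp, LinearMap.range_comp]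
    exact Submodule.finrank_map_le _ _
  rank_comp_le_right f g := by
    rw [toLin, FGModuleCat.hom_hom_comp]
    exact Submodule.finrank_mono (LinearMap.range_comp_le_range _ _)
  exists_factorization f := exists_factorization_of_finrank_range f rfl
  rank_id_std n := by
    rw [toLin, FGModuleCat.hom_hom_id, LinearMap.range_id, finrank_top]
    exact Module.finrank_fin_fun F
  isIso_of_rank_eq {n} f hf := by
    have hker := ker_eq_bot_of_finrank_range f hf
    let e := LinearEquiv.ofInjectiveEndo (toLin f) (LinearMap.ker_eq_bot.1 hker)
    refine ⟨ofLin e.symm.toLinearMap, ?_, ?_⟩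
    · exact FGModuleCat.hom_ext (LinearMap.ext fun x => e.symm_apply_apply x)
    · exact FGModuleCat.hom_ext (LinearMap.ext fun x => e.apply_symm_apply x)
  mono_of_rank_eq {n Y} f hf := by
    have hker := LinearMap.ker_eq_bot.1 (ker_eq_bot_of_finrank_range f hf)
    refine ⟨fun g h hgh => FGModuleCat.hom_ext (LinearMap.ext fun x => hker ?_)⟩
    exact LinearMap.congr_fun (congrArg toLin hgh) x

/-- The trace pairing between morphisms in opposite directions. -/
noncomputable def tracePairing (X Y : FGModuleCat.{u} F) : (Y ⟶ X) →ₗ[F] (X ⟶ Y) →ₗ[F] F :=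
  LinearMap.mk₂ F (fun b f => LinearMap.trace F X (toLin b ∘ₗ toLin f))
    (fun b b' f => by rw [← map_add, ← LinearMap.add_comp]; rfl)
    (fun c b f => by rw [← map_smul, ← LinearMap.smul_comp]; rfl)
    (fun b f f' => by rw [← map_add, ← LinearMap.comp_add]; rfl)
    (fun c b f => by rw [← map_smul, ← LinearMap.comp_smul]; rfl)

/-- Testing against the rank one maps `φ.smulRight x` gives `φ (f x) = 0` for every functional `φ`.
-/
lemma eq_zero_of_tracePairing {X Y : FGModuleCat.{u} F} (f : X ⟶ Y)
    (h : ∀ b, tracePairing X Y b f = 0) : f = 0 := by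
  refine FGModuleCat.hom_ext (LinearMap.ext fun x => ?_)
  change toLin f x = 0
  refine (Module.forall_dual_apply_eq_zero_iff F _).1 fun φ => ?_
  have h1 : LinearMap.trace F X (φ.smulRight x ∘ₗ toLin f) = 0 := h (ofLin (φ.smulRight x))
  have h2 : φ.smulRight x ∘ₗ toLin f = (φ ∘ₗ toLin f).smulRight x := rfl
  rwa [h2, LinearMap.trace_smulRight] at h1

variable [Finite F]

instance (X Y : FGModuleCat.{u} F) : Finite (X ⟶ Y) := Module.finite_of_finite F

/-- The trace pairing of `b` with `f` depends only on the composite `f ≫ b`, or equally `b ≫ f`. If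
all composites of `x` vanish, its coefficients therefore sum to zero over every hyperplane for this
pairing, and Radon inversion applies: the number of maps `Y ⟶ X` is a power of `p`, nonzero in `K`.
-/
lemma separatesHoms (p : ℕ) [CharP F p] (K : Type v) [Field K] (hK : ringChar K ≠ p) :
    SeparatesHoms K (FGModuleCat.{u} F) := by
  classical
  have := Fintype.ofFinite F
  have hp : p.Prime := CharP.char_is_prime F p
  have hpK : (p : K) ≠ 0 := by
    intro h0
    rcases (Nat.dvd_prime hp).1 (ringChar.dvd h0) with h | h
    · exact CharP.ringChar_ne_one h
    · exact hK h
  have hcard : ∀ X Y : FGModuleCat.{u} F, (Nat.card (X ⟶ Y) : K) ≠ 0 := by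
    intro X Y
    have := Fintype.ofFinite (X ⟶ Y)
    obtain ⟨n, -, hn⟩ := FiniteField.card F p
    rw [Nat.card_eq_fintype_card, Module.card_eq_pow_finrank (K := F), hn]
    push_cast
    exact pow_ne_zero _ (pow_ne_zero _ hpK)
  have key : ∀ (X Y : FGModuleCat.{u} F) (x : LHom K X Y), (∀ (b : Y ⟶ X) (c : F),
      Finsupp.linearCombination K (fun f : X ⟶ Y => if tracePairing X Y b f = c then (1 : K) else 0)
        x = 0) → x = 0 := by
    intro X Y x hx
    have := Fintype.ofFinite (X ⟶ Y)
    have := Fintype.ofFinite (Y ⟶ X)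
    have h0 : (fun f => coef K f x) = 0 := by
      refine eq_zero_of_sum_hyperplane_eq_zero (F := F) (N := Y ⟶ X) ?_ (tracePairing X Y)
        eq_zero_of_tracePairing _ fun b c => ?_
      · rw [← Nat.card_eq_fintype_card]
        exact hcard _ _
      · refine Eq.trans ?_ (hx b c)
        refine Eq.trans ?_ (Finsupp.sum_fintype (α := X ⟶ Y) x
          (fun f d => d • (if tracePairing X Y b f = c then (1 : K) else 0))
          fun f => zero_smul K _).symm
        refine Finset.sum_congr rfl fun f _ => ?_
        simp only [smul_eq_mul, mul_ite, mul_one, mul_zero]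
        rfl
    exact lhom_ext_coef fun f => (congrFun h0 f).trans (map_zero _).symm
  have lin : ∀ (X Y : FGModuleCat.{u} F) (x : LHom K X Y) (b : Y ⟶ X) (c : F)
      (Z : FGModuleCat.{u} F) (T : LHom K X Y →ₗ[K] LHom K Z Z),
      (∀ f, ∃ g, T (sg K f) = sg K g ∧ LinearMap.trace F Z (toLin g) = tracePairing X Y b f) →
      T x = 0 → Finsupp.linearCombination K
        (fun f : X ⟶ Y => if tracePairing X Y b f = c then (1 : K) else 0) x = 0 := by
    intro X Y x b c Z T hT hx
    let ψ : LHom K Z Z →ₗ[K] K := Finsupp.linearCombination K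
      (fun g : Z ⟶ Z => if LinearMap.trace F Z (toLin g) = c then (1 : K) else 0)
    have h1 : (Finsupp.linearCombination K
        (fun f : X ⟶ Y => if tracePairing X Y b f = c then (1 : K) else 0) :
          LHom K X Y →ₗ[K] K) = ψ ∘ₗ T := by
      refine linearMap_ext_sg fun f => ?_
      obtain ⟨g, hg, hg'⟩ := hT f
      rw [LinearMap.comp_apply, hg]
      refine (Finsupp.linearCombination_single K (1 : K) f).trans ?_
      refine Eq.trans ?_ (Finsupp.linearCombination_single K (1 : K) g).symm
      rw [hg']
    refine (LinearMap.congr_fun h1 x).trans ?_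
    rw [LinearMap.comp_apply, hx, map_zero]
  refine ⟨fun {X Y} x hx => key X Y x fun b c => ?_, fun {X Y} x hx => key X Y x fun b c => ?_⟩
  · refine lin X Y x b c X (Linear.rightComp K _ (sg K b)) (fun f => ⟨f ≫ b, ?_, rfl⟩) (hx b)
    exact (sg_comp K f b).symm
  · refine lin X Y x b c Y (Linear.leftComp K _ (sg K b)) (fun f => ⟨b ≫ f, ?_, ?_⟩) (hx b)
    · exact (sg_comp K b f).symm
    · exact LinearMap.trace_comp_comm' (toLin b) (toLin f)

end FiniteField
end GenericRep

theorem corollary1p2 (p : ℕ) (F : Type u) [Field F] [Finite F] [CharP F p]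
    (K : Type v) [Field K] (hK : ringChar K ≠ p) :
    (∀ P : GenericRep F K, Projective P → Injective P) ∧
      (∀ P : GenericRep F K, Projective P → Indecomposable P →
        HasFinitelyManyCompositionFactors P) := by
  have := GenericRep.separatesHoms (F := F) p K hK
  exact ⟨fun P hP => GenericRep.injective_of_projective hP,
    fun P hP hI => GenericRep.hasFinitelyManyCompositionFactors_of_projective hP hI⟩
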